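/- Let $(\Omega,\mathfrak F,\mathbb P)$ be a complete probability space, $(\theta_t)_{t\in\mathbb R}$ an ergodic metric dynamical system on it (jointly measurable, $\mathbb P$-preserving flow), $N\ge 2$, $1<p<\infty$, $1/p+1/q=1$. Let $A,B\colon\Omega\to\mathbb R^{N\times N}$ be measurable with $\|A\|\in L_1(\mathbb P)$ and $\omega\mapsto \ln^+\int_0^1\|B(\theta_r\omega)\|^q\,dr$ in $L_1(\mathbb P)$ (matrix norm induced by the Euclidean norm). Put $A$ and $B$ equal to $0$ on the invariant $\mathbb P$-null set of those $\omega$ for which $t\mapsto\|A(\theta_t\omega)\|$ is not in $L_{1,\mathrm{loc}}(\mathbb R)$ or $t\mapsto\|B(\theta_t\omega)\|$ is not in $L_{q,\mathrm{loc}}(\mathbb R)$. Let $C=C([-1,0],\mathbb R^N)$ with the supremum norm, $L=\mathbb R^N\times L_p([-1,0],\mathbb R^N)$ with the norm $\|u_1\|+\|u_2\|_p$, and $J\colon C\to L$, $Ju=(u(0),u)$. For $t\ge 0$ let $U^{(C)}_\omega(t)u=z_t$, where $z_t(s)=z(t+s)$ for $s\in[-1,0]$ and $z$ is the Carathéodory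 solution of $$z'(t)=A(\theta_t\omega)z(t)+B(\theta_t\omega)z(t-1)\quad (t\ge 0)$$ with $z=u$ on $[-1,0]$, $u\in C$; and let $U^{(L)}_\omega(t)u=(z(t),z_t)$, where $z$ is the solution with $z(0)=u_1$ and $z=u_2$ a.e. on $[-1,0)$, $u=(u_1,u_2)\in L$. Let $\Phi^{(C)}=((U^{(C)}_\omega(t)),(\theta_t))$ and $\Phi^{(L)}=((U^{(L)}_\omega(t)),(\theta_t))$. A system $\Phi=((U_\omega(t)),(\theta_t))$ of bounded linear operators on a Banach space $X$ admits an Oseledets decomposition if there is an invariant set $\Omega_0\in\mathfrak F$ with $\mathbb P(\Omega_0)=1$ such that one of the following holds (with $\ln 0=-\infty$). Case (I): there are $k\ge 1$ real numbers $\lambda_1>\dots>\lambda_k$ with $\lambda_1=\lim_{t\to\infty}\frac1t\ln\|U_\omega(t)\|$ for $\mathbb P$-a.e. $\omega$, families $\{E_i(\omega)\}_{\omega\in\Omega_0}$, $1\le i\le k$, of finite-dimensional subspaces (each of constant dimension and having a basis that depends measurably on $\omega$), and closed finite-codimensional subspaces $F_\infty(\omega)$ such that for all $\omega\in\Omega_0$,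 $t\ge0$: (a) $U_\omega(t)E_i(\omega)=E_i(\theta_t\omega)$ and $U_\omega(t)F_\infty(\omega)\subset F_\infty(\theta_t\omega)$; (b) $E_1(\omega)\oplus\dots\oplus E_k(\omega)\oplus F_\infty(\omega)=X$; put $F_i(\omega)=E_{i+1}(\omega)\oplus\dots\oplus E_k(\omega)\oplus F_\infty(\omega)$ for $0\le i\le k$, so $F_0(\omega)=X$ and $F_k(\omega)=F_\infty(\omega)$; (c) for $1\le i\le k$ the projections $P(\omega)$ onto $F_i(\omega)$ along $\bigoplus_{j\le i}E_j(\omega)$ are strongly measurable and tempered, that is, $\frac1t\ln\|P(\theta_t\omega)\|\to0$ as $t\to\pm\infty$, $\mathbb P$-a.e.; (d) $\lim_{t\to\infty}\frac1t\ln\|U_\omega(t)|_{E_i(\omega)}\|=\lim_{t\to\infty}\frac1t\ln\|U_\omega(t)u\|=\lambda_i$ for $0\ne u\in E_i(\omega)$; (e) $\lim_{t\to\infty}\frac1t\ln\|U_\omega(t)u\|=\lambda_i$ for $u\in F_{i-1}(\omega)\setminus F_i(\omega)$, $1\le i\le k$; (f) a nonzero $u\in F_{i-1}(\omega)$ belongs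 to $E_i(\omega)$ if and only if there is a negative semiorbit through $(\omega,u)$, that is, a Borel map $\tilde u\colon(-\infty,0]\to X$ with $\tilde u(0)=u$ and $\tilde u(t+s)=U_{\theta_s\omega}(t)\tilde u(s)$ whenever $s\le0\le t$ and $s+t\le0$, such that $\lim_{s\to-\infty}\frac1s\ln\|\tilde u(s)\|=\lambda_i$; (g) $\lim_{t\to\infty}\frac1t\ln\|U_\omega(t)|_{F_\infty(\omega)}\|=-\infty$. Case (II): there are real numbers $\lambda_1>\lambda_2>\dots\to-\infty$, with $\lambda_1$ as above, measurable families $E_i(\omega)$ as above and closed finite-codimensional subspaces $F_i(\omega)$, $i\in\mathbb N$, $F_0(\omega)=X$, such that for all $i\in\mathbb N$, $\omega\in\Omega_0$, $t\ge0$: $U_\omega(t)E_i(\omega)=E_i(\theta_t\omega)$ and $U_\omega(t)F_i(\omega)\subset F_i(\theta_t\omega)$; $E_1(\omega)\oplus\dots\oplus E_i(\omega)\oplus F_i(\omega)=X$ and $F_i(\omega)=E_{i+1}(\omega)\oplus F_{i+1}(\omega)$; (c)–(f) of case (I) hold for every $i\in\mathbb N$; $\lim_{t\to\infty}\frac1t\ln\|U_\omega(t)|_{F_i(\omega)}\|=\lambda_{i+1}$;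 and $\lim_{t\to\infty}\frac1t\ln\|U_\omega(t)u\|=-\infty$ for $0\neq u\in\bigcap_jF_j(\omega)$. **Theorem.** Assume that both $\Phi^{(C)}$ and $\Phi^{(L)}$ admit Oseledets decompositions, and let $E_i^{(C)}$, $E_i^{(L)}$ be the subspaces of any such decompositions. Then both decompositions are of case (I) with the same $k$, or both are of case (II); and for every $i\in\{1,\dots,k\}$ in case (I), or every $i\in\mathbb N$ in case (II), $$J\bigl(E_i^{(C)}(\omega)\bigr)=E_i^{(L)}(\omega)\quad\text{for }\mathbb P\text{-a.e. }\omega\in\Omega .$$ -/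

import Mathlib

open MeasureTheory Set Filter Topology
open scoped ENNReal

noncomputable section

namespace DelayRDS

/-! ### Metric dynamical systems -/

/-- `θ` is a metric dynamical system on `(Ω, P)`: a jointly measurable `P`-preserving flow
with time `ℝ`. -/
structure IsMetricDynamicalSystem {Ω : Type*} [MeasurableSpace Ω]
    (θ : ℝ → Ω → Ω) (P : Measure Ω) : Prop where
  measurable : Measurable (fun x : ℝ × Ω => θ x.1 x.2)
  zero : ∀ ω, θ 0 ω = ω
  add : ∀ t₁ t₂ ω, θ (t₁ + t₂) ω = θ t₂ (θ t₁ ω)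
  preserving : ∀ t, MeasurePreserving (θ t) P P

/-- A set is invariant if `θ_t⁻¹(S) = S` for all `t ∈ ℝ`. -/
def IsInvariantSet {Ω : Type*} (θ : ℝ → Ω → Ω) (S : Set Ω) : Prop :=
  ∀ t, θ t ⁻¹' S = S

/-- Ergodicity: invariant measurable sets have measure `0` or `1`. -/
def IsErgodicFlow {Ω : Type*} [MeasurableSpace Ω] (θ : ℝ → Ω → Ω) (P : Measure Ω) : Prop :=
  ∀ S, MeasurableSet S → IsInvariantSet θ S → P S = 0 ∨ P S = 1

/-! ### Oseledets decompositions -/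

/-- `(ln x) / t`, with `ln 0 = -∞`, for `x ∈ [0, ∞]` and `t ∈ ℝ`. -/
def expRate (x : ℝ≥0∞) (t : ℝ) : EReal := ENNReal.log x / (t : EReal)

/-- A negative semiorbit of `U` through `(ω, u)`. Only the values of `v` on `(-∞, 0]` matter. -/
structure IsNegativeSemiorbit {Ω X : Type*} [NormedAddCommGroup X] [NormedSpace ℝ X]
    (θ : ℝ → Ω → Ω) (U : ℝ → Ω → X →L[ℝ] X) (ω : Ω) (u : X) (v : ℝ → X) : Prop where
  measurable : Measurable[_, borel X] ((Iic (0 : ℝ)).domRestrict v)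
  zero : v 0 = u
  orbit : ∀ s t : ℝ, s ≤ 0 → 0 ≤ t → s + t ≤ 0 → v (t + s) = U t (θ s ω) (v s)

/-- `{E(ω)}_{ω ∈ Ω₀}` is a measurable family of subspaces of one and the same finite
dimension `l`. -/
def IsMeasurableFamily {Ω X : Type*} [MeasurableSpace Ω] [NormedAddCommGroup X]
    [NormedSpace ℝ X] (Ω₀ : Set Ω) (E : Ω → Submodule ℝ X) : Prop :=
  ∃ (l : ℕ) (v : Fin l → Ω → X),
    (∀ j, Measurable[_, borel X] (Ω₀.domRestrict (v j))) ∧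
    ∀ ω ∈ Ω₀, LinearIndependent ℝ (fun j => v j ω) ∧
      Submodule.span ℝ (range fun j => v j ω) = E ω

/-- `{Q(ω)}_{ω ∈ Ω₀}` is the family of projections onto `F(ω)` along `E(ω)` associated with a
decomposition `E(ω) ⊕ F(ω) = X`. -/
def IsProjectionFamily {Ω X : Type*} [NormedAddCommGroup X] [NormedSpace ℝ X]
    (Ω₀ : Set Ω) (E F : Ω → Submodule ℝ X) (Q : Ω → X →L[ℝ] X) : Prop :=
  ∀ ω ∈ Ω₀, IsCompl (E ω) (F ω) ∧ (∀ x ∈ F ω, Q ω x = x) ∧ (∀ x ∈ E ω, Q ω x = 0)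

/-- The family of projections associated with `E(ω) ⊕ F(ω) = X` is strongly measurable and
tempered. -/
def HasTemperedProjections {Ω X : Type*} [MeasurableSpace Ω] [NormedAddCommGroup X]
    [NormedSpace ℝ X] (θ : ℝ → Ω → Ω) (P : Measure Ω) (Ω₀ : Set Ω)
    (E F : Ω → Submodule ℝ X) : Prop :=
  ∃ Q : Ω → X →L[ℝ] X, IsProjectionFamily Ω₀ E F Q ∧
    (∀ u : X, Measurable[_, borel X] (Ω₀.domRestrict fun ω => Q ω u)) ∧
    ∀ᵐ ω ∂P, ω ∈ Ω₀ →
      Tendsto (fun t : ℝ => expRate ‖Q (θ t ω)‖ₑ t) atTop (𝓝 0) ∧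
      Tendsto (fun t : ℝ => expRate ‖Q (θ t ω)‖ₑ t) atBot (𝓝 0)

/-- `E₁ ⊕ ... ⊕ E_n ⊕ F = X` (internal direct sum). -/
def IsDirectSumDecomposition {X : Type*} [NormedAddCommGroup X] [NormedSpace ℝ X] {n : ℕ}
    (E : Fin n → Submodule ℝ X) (F : Submodule ℝ X) : Prop :=
  iSupIndep E ∧ IsCompl (⨆ j, E j) F

/-- The filtration of case (I): `F_i = E_{i+1} ⊕ ... ⊕ E_k ⊕ F_∞`. Since `E` is indexed from
`0` here, the summands are the `E j` with `i ≤ j`. For `i = k` this is `F_∞`; for `i = 0` it is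
the whole space as soon as `E_1 ⊕ ... ⊕ E_k ⊕ F_∞ = X`. -/
def finiteFiltration {Ω X : Type*} [NormedAddCommGroup X] [NormedSpace ℝ X] {k : ℕ}
    (E : Fin k → Ω → Submodule ℝ X) (Finf : Ω → Submodule ℝ X) (i : ℕ) (ω : Ω) :
    Submodule ℝ X :=
  (⨆ (j : Fin k) (_ : i ≤ (j : ℕ)), E j ω) ⊔ Finf ω

/-- Oseledets decomposition, case (I): finitely many exponents `λ_1 > ... > λ_k` (here
`lam 0 > ... > lam (k - 1)`). Values of `E`, `Finf` off the invariant set `Ω₀` are irrelevant. -/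
structure FiniteOseledets {Ω X : Type*} [MeasurableSpace Ω] [NormedAddCommGroup X]
    [NormedSpace ℝ X] (θ : ℝ → Ω → Ω) (P : Measure Ω) (U : ℝ → Ω → X →L[ℝ] X) (k : ℕ) where
  Ω₀ : Set Ω
  measurableSet : MeasurableSet Ω₀
  invariant : IsInvariantSet θ Ω₀
  full : P Ω₀ = 1
  k_pos : 0 < k
  lam : Fin k → ℝ
  lam_anti : StrictAnti lam
  /-- `λ_1` is the top Lyapunov exponent. -/
  lam_top : ∀ᵐ ω ∂P, Tendsto (fun t : ℝ => expRate ‖U t ω‖ₑ t) atTop (𝓝 (lam ⟨0, k_pos⟩ : EReal))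
  E : Fin k → Ω → Submodule ℝ X
  E_measurable : ∀ i, IsMeasurableFamily Ω₀ (E i)
  Finf : Ω → Submodule ℝ X
  Finf_closed : ∀ ω ∈ Ω₀, IsClosed (Finf ω : Set X)
  Finf_codim : ∀ ω ∈ Ω₀, FiniteDimensional ℝ (X ⧸ Finf ω)
  /-- (a) -/
  E_invariant : ∀ i, ∀ ω ∈ Ω₀, ∀ t : ℝ, 0 ≤ t →
    (E i ω).map (U t ω : X →ₗ[ℝ] X) = E i (θ t ω)
  Finf_invariant : ∀ ω ∈ Ω₀, ∀ t : ℝ, 0 ≤ t →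
    (Finf ω).map (U t ω : X →ₗ[ℝ] X) ≤ Finf (θ t ω)
  /-- (b) -/
  direct_sum : ∀ ω ∈ Ω₀, IsDirectSumDecomposition (fun i => E i ω) (Finf ω)
  /-- (c) for `1 ≤ i ≤ k`, the case `i = k` being that of `F_∞` -/
  tempered : ∀ i : ℕ, 1 ≤ i → i ≤ k →
    HasTemperedProjections θ P Ω₀ (fun ω => ⨆ (j : Fin k) (_ : (j : ℕ) < i), E j ω)
      (finiteFiltration E Finf i)
  /-- (d) -/
  rate_norm_E : ∀ i, ∀ ω ∈ Ω₀,
    Tendsto (fun t : ℝ => expRate ‖(U t ω).comp (E i ω).subtypeL‖ₑ t) atTop (𝓝 (lam i : EReal))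
  rate_E : ∀ i, ∀ ω ∈ Ω₀, ∀ u ∈ E i ω, u ≠ 0 →
    Tendsto (fun t : ℝ => expRate ‖U t ω u‖ₑ t) atTop (𝓝 (lam i : EReal))
  /-- (e), and (f) for the last index -/
  rate_filtration : ∀ i : Fin k, ∀ ω ∈ Ω₀, ∀ u ∈ finiteFiltration E Finf i ω,
    u ∉ finiteFiltration E Finf (i + 1) ω →
    Tendsto (fun t : ℝ => expRate ‖U t ω u‖ₑ t) atTop (𝓝 (lam i : EReal))
  /-- (g) -/
  mem_E_iff : ∀ i : Fin k, ∀ ω ∈ Ω₀, ∀ u ∈ finiteFiltration E Finf i ω, u ≠ 0 →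
    (u ∈ E i ω ↔ ∃ v : ℝ → X, IsNegativeSemiorbit θ U ω u v ∧
      Tendsto (fun s : ℝ => expRate ‖v s‖ₑ s) atBot (𝓝 (lam i : EReal)))
  /-- (h) -/
  rate_Finf : ∀ ω ∈ Ω₀,
    Tendsto (fun t : ℝ => expRate ‖(U t ω).comp (Finf ω).subtypeL‖ₑ t) atTop (𝓝 ⊥)

/-- Oseledets decomposition, case (II): infinitely many exponents `λ_1 > λ_2 > ... → -∞`.
Here `lam i`, `E i` are `λ_{i+1}`, `E_{i+1}`, while `F i` is `F_i`, with `F_0 = X`. -/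
structure InfiniteOseledets {Ω X : Type*} [MeasurableSpace Ω] [NormedAddCommGroup X]
    [NormedSpace ℝ X] (θ : ℝ → Ω → Ω) (P : Measure Ω) (U : ℝ → Ω → X →L[ℝ] X) where
  Ω₀ : Set Ω
  measurableSet : MeasurableSet Ω₀
  invariant : IsInvariantSet θ Ω₀
  full : P Ω₀ = 1
  lam : ℕ → ℝ
  lam_anti : StrictAnti lam
  lam_lim : Tendsto lam atTop atBot
  /-- `λ_1` is the top Lyapunov exponent. -/
  lam_top : ∀ᵐ ω ∂P, Tendsto (fun t : ℝ => expRate ‖U t ω‖ₑ t) atTop (𝓝 (lam 0 : EReal))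
  E : ℕ → Ω → Submodule ℝ X
  E_measurable : ∀ i, IsMeasurableFamily Ω₀ (E i)
  F : ℕ → Ω → Submodule ℝ X
  F_zero : ∀ ω ∈ Ω₀, F 0 ω = ⊤
  F_closed : ∀ i, ∀ ω ∈ Ω₀, IsClosed (F i ω : Set X)
  F_codim : ∀ i, ∀ ω ∈ Ω₀, FiniteDimensional ℝ (X ⧸ F i ω)
  /-- (a) -/
  E_invariant : ∀ i, ∀ ω ∈ Ω₀, ∀ t : ℝ, 0 ≤ t →
    (E i ω).map (U t ω : X →ₗ[ℝ] X) = E i (θ t ω)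
  F_invariant : ∀ i, ∀ ω ∈ Ω₀, ∀ t : ℝ, 0 ≤ t →
    (F i ω).map (U t ω : X →ₗ[ℝ] X) ≤ F i (θ t ω)
  /-- (b) -/
  direct_sum : ∀ n : ℕ, ∀ ω ∈ Ω₀, IsDirectSumDecomposition (fun i : Fin n => E i ω) (F n ω)
  F_split : ∀ i, ∀ ω ∈ Ω₀, Disjoint (E i ω) (F (i + 1) ω) ∧ F i ω = E i ω ⊔ F (i + 1) ω
  /-- (c) -/
  tempered : ∀ i : ℕ, 1 ≤ i →
    HasTemperedProjections θ P Ω₀ (fun ω => ⨆ j : Fin i, E j ω) (F i)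
  /-- (d) -/
  rate_norm_E : ∀ i, ∀ ω ∈ Ω₀,
    Tendsto (fun t : ℝ => expRate ‖(U t ω).comp (E i ω).subtypeL‖ₑ t) atTop (𝓝 (lam i : EReal))
  rate_E : ∀ i, ∀ ω ∈ Ω₀, ∀ u ∈ E i ω, u ≠ 0 →
    Tendsto (fun t : ℝ => expRate ‖U t ω u‖ₑ t) atTop (𝓝 (lam i : EReal))
  /-- (e) -/
  rate_filtration : ∀ i, ∀ ω ∈ Ω₀, ∀ u ∈ F i ω, u ∉ F (i + 1) ω →
    Tendsto (fun t : ℝ => expRate ‖U t ω u‖ₑ t) atTop (𝓝 (lam i : EReal))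
  /-- (f) -/
  mem_E_iff : ∀ i, ∀ ω ∈ Ω₀, ∀ u ∈ F i ω, u ≠ 0 →
    (u ∈ E i ω ↔ ∃ v : ℝ → X, IsNegativeSemiorbit θ U ω u v ∧
      Tendsto (fun s : ℝ => expRate ‖v s‖ₑ s) atBot (𝓝 (lam i : EReal)))
  /-- (g) -/
  rate_norm_F : ∀ i : ℕ, 1 ≤ i → ∀ ω ∈ Ω₀,
    Tendsto (fun t : ℝ => expRate ‖(U t ω).comp (F i ω).subtypeL‖ₑ t) atTop (𝓝 (lam i : EReal))
  /-- (h) -/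
  rate_Finf : ∀ ω ∈ Ω₀, ∀ u, (∀ i, u ∈ F i ω) → u ≠ 0 →
    Tendsto (fun t : ℝ => expRate ‖U t ω u‖ₑ t) atTop (𝓝 ⊥)

/-- An Oseledets decomposition of `((U_ω(t)), (θ_t))`. -/
inductive OseledetsDecomposition {Ω X : Type*} [MeasurableSpace Ω] [NormedAddCommGroup X]
    [NormedSpace ℝ X] (θ : ℝ → Ω → Ω) (P : Measure Ω) (U : ℝ → Ω → X →L[ℝ] X) where
  | caseI (k : ℕ) (D : FiniteOseledets θ P U k) : OseledetsDecomposition θ P U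
  | caseII (D : InfiniteOseledets θ P U) : OseledetsDecomposition θ P U

/-- The number of Lyapunov exponents: `k` in case (I), `∞` in case (II). -/
def OseledetsDecomposition.count {Ω X : Type*} [MeasurableSpace Ω] [NormedAddCommGroup X]
    [NormedSpace ℝ X] {θ : ℝ → Ω → Ω} {P : Measure Ω} {U : ℝ → Ω → X →L[ℝ] X} :
    OseledetsDecomposition θ P U → ℕ∞
  | .caseI k _ => k
  | .caseII _ => ⊤

/-- The Oseledets subspace with index `i`, counted from `0`, for `i < count`. -/
def OseledetsDecomposition.space {Ω X : Type*} [MeasurableSpace Ω] [NormedAddCommGroup X]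
    [NormedSpace ℝ X] {θ : ℝ → Ω → Ω} {P : Measure Ω} {U : ℝ → Ω → X →L[ℝ] X} :
    OseledetsDecomposition θ P U → ℕ → Ω → Submodule ℝ X
  | .caseI k D => fun i ω => if h : i < k then D.E ⟨i, h⟩ ω else ⊥
  | .caseII D => fun i ω => D.E i ω

/-! ### The spaces `C` and `L` -/

/-- The delay interval `[-1, 0]`. -/
abbrev DelayInterval : Type := Icc (-1 : ℝ) 0

/-- Lebesgue measure on `[-1, 0]`. -/
def delayMeasure : Measure DelayInterval := Measure.comap Subtype.val volume

instance : IsFiniteMeasure delayMeasure := by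
  constructor
  rw [delayMeasure, comap_subtype_coe_apply measurableSet_Icc, image_univ, Subtype.range_coe]
  exact measure_Icc_lt_top

/-- The point `0` of `[-1, 0]`. -/
def zeroPt : DelayInterval := ⟨0, by norm_num, le_rfl⟩

/-- `ℝ^N` with the Euclidean norm. -/
abbrev Vec (N : ℕ) : Type := EuclideanSpace ℝ (Fin N)

/-- `C = C([-1, 0], ℝ^N)` with the supremum norm. -/
abbrev SpaceC (N : ℕ) : Type := C(DelayInterval, Vec N)

/-- `L = ℝ^N × L_p([-1, 0], ℝ^N)` with the norm `‖u₁‖ + ‖u₂‖_p`. -/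
abbrev SpaceL (p : ℝ≥0∞) (N : ℕ) : Type :=
  WithLp 1 (Vec N × Lp (Vec N) p delayMeasure)

/-- `J : C → L`, `J u = (u(0), u)`. -/
def embJ (p : ℝ≥0∞) [Fact (1 ≤ p)] (N : ℕ) : SpaceC N →L[ℝ] SpaceL p N :=
  ((WithLp.prodContinuousLinearEquiv 1 ℝ (Vec N)
      (Lp (Vec N) p delayMeasure)).symm :
      (Vec N × Lp (Vec N) p delayMeasure) →L[ℝ] SpaceL p N).comp
    ((ContinuousMap.evalCLM ℝ zeroPt).prod
      (ContinuousMap.toLp p delayMeasure ℝ))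

/-! ### The delay differential equation and its solution operators -/

/-- The operator on Euclidean `ℝ^N` with matrix `M`; its norm is the matrix norm induced by the
Euclidean norm. -/
def matOp {N : ℕ} (M : Matrix (Fin N) (Fin N) ℝ) : Vec N →L[ℝ] Vec N :=
  Matrix.toEuclideanCLM (n := Fin N) (𝕜 := ℝ) M

/-- Along the orbit of `ω`, `‖A(θ_t ω)‖` is locally integrable and `‖B(θ_t ω)‖` is locally
`q`-integrable. -/
def IsRegularPoint {Ω : Type*} {N : ℕ} (θ : ℝ → Ω → Ω) (q : ℝ≥0∞)
    (A B : Ω → Matrix (Fin N) (Fin N) ℝ) (ω : Ω) : Prop :=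
  LocallyIntegrable (fun t : ℝ => ‖matOp (A (θ t ω))‖) ∧
  ∀ K : Set ℝ, IsCompact K → MemLp (fun t : ℝ => ‖matOp (B (θ t ω))‖) q (volume.restrict K)

open Classical in
/-- The coefficient `M` (one of `A`, `B`), put equal to zero at the points that are not regular.
These form an invariant set, of measure zero under the integrability assumptions. -/
def coeff {Ω : Type*} {N : ℕ} (θ : ℝ → Ω → Ω) (q : ℝ≥0∞)
    (A B : Ω → Matrix (Fin N) (Fin N) ℝ) (M : Ω → Matrix (Fin N) (Fin N) ℝ) (ω : Ω) :
    Vec N →L[ℝ] Vec N :=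
  if IsRegularPoint θ q A B ω then matOp (M ω) else 0

/-- `z` satisfies `z'(t) = a(t) z(t) + b(t) z(t - 1)` on `[0, ∞)` in the sense of Carathéodory:
it is continuous on `[0, ∞)` and satisfies the integrated equation. -/
def SolvesDelayEquation {N : ℕ} (a b : ℝ → Vec N →L[ℝ] Vec N) (z : ℝ → Vec N) : Prop :=
  ContinuousOn z (Ici 0) ∧
  ∀ t : ℝ, 0 ≤ t →
    IntervalIntegrable (fun s => a s (z s) + b s (z (s - 1))) volume 0 t ∧
    z t = z 0 + ∫ s in (0 : ℝ)..t, (a s (z s) + b s (z (s - 1)))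

/-- `T` is the solution operator on `C`: it maps each `u` to the segment
`z_t : s ↦ z(t + s)` of the solution `z` with `z = u` on `[-1, 0]`. -/
def IsSolutionOperatorC {N : ℕ} (a b : ℝ → Vec N →L[ℝ] Vec N) (t : ℝ)
    (T : SpaceC N →L[ℝ] SpaceC N) : Prop :=
  ∀ u : SpaceC N, ∃ z : ℝ → Vec N, SolvesDelayEquation a b z ∧
    (∀ s : DelayInterval, z s = u s) ∧ ∀ s : DelayInterval, T u s = z (t + s)

/-- `T` is the solution operator on `L`: it maps each `u = (u₁, u₂)` to `(z(t), z_t)`, where `z`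
is the solution with `z(0) = u₁` and `z = u₂` almost everywhere on `[-1, 0)`. -/
def IsSolutionOperatorL {N : ℕ} (p : ℝ≥0∞) [Fact (1 ≤ p)] (a b : ℝ → Vec N →L[ℝ] Vec N) (t : ℝ)
    (T : SpaceL p N →L[ℝ] SpaceL p N) : Prop :=
  ∀ u : SpaceL p N, ∃ z : ℝ → Vec N, SolvesDelayEquation a b z ∧
    z 0 = u.fst ∧ (∀ᵐ s : DelayInterval ∂delayMeasure, z s = u.snd s) ∧
    (T u).fst = z t ∧ ∀ᵐ s : DelayInterval ∂delayMeasure, (T u).snd s = z (t + s)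

open Classical in
/-- `U^(C)_ω(t)` for `t ≥ 0`: the solution operator on `C` of
`z'(t) = A(θ_t ω) z(t) + B(θ_t ω) z(t - 1)`. -/
def semiflowC {Ω : Type*} {N : ℕ} (θ : ℝ → Ω → Ω) (q : ℝ≥0∞)
    (A B : Ω → Matrix (Fin N) (Fin N) ℝ) (t : ℝ) (ω : Ω) : SpaceC N →L[ℝ] SpaceC N :=
  if h : ∃ T, IsSolutionOperatorC (fun s => coeff θ q A B A (θ s ω))
      (fun s => coeff θ q A B B (θ s ω)) t T
  then h.choose else 0

open Classical in
/-- `U^(L)_ω(t)` for `t ≥ 0`: the solution operator on `L` of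
`z'(t) = A(θ_t ω) z(t) + B(θ_t ω) z(t - 1)`. -/
def semiflowL {Ω : Type*} {N : ℕ} (p : ℝ≥0∞) [Fact (1 ≤ p)] (θ : ℝ → Ω → Ω) (q : ℝ≥0∞)
    (A B : Ω → Matrix (Fin N) (Fin N) ℝ) (t : ℝ) (ω : Ω) : SpaceL p N →L[ℝ] SpaceL p N :=
  if h : ∃ T, IsSolutionOperatorL p (fun s => coeff θ q A B A (θ s ω))
      (fun s => coeff θ q A B B (θ s ω)) t T
  then h.choose else 0

/-- Summability of the coefficients: `‖A‖` is in `L₁(P)`, and so is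
`ω ↦ ln⁺ ∫₀¹ ‖B(θ_r ω)‖^q dr` (`EReal.toENNReal` is the positive part). -/
def IsSummableCoefficients {Ω : Type*} [MeasurableSpace Ω] {N : ℕ} (θ : ℝ → Ω → Ω)
    (P : Measure Ω) (q : ℝ≥0∞) (A B : Ω → Matrix (Fin N) (Fin N) ℝ) : Prop :=
  Integrable (fun ω => ‖matOp (A ω)‖) P ∧
  ∫⁻ ω, (ENNReal.log (∫⁻ r in Icc (0 : ℝ) 1, ‖matOp (B (θ r ω))‖ₑ ^ q.toReal)).toENNReal ∂P < ⊤

end DelayRDS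

end

open DelayRDS

/-!
After one unit of time the delay equation smooths: if `z` solves it with initial data `u ∈ L`,
then the segment `z_1` is continuous, and `K_ω u = z_1` defines a bounded operator
`K_ω : L → C` with `J ∘ K_ω = U^(L)_ω(1)`. Since also `J ∘ U^(C)_ω(t) = U^(L)_ω(t) ∘ J`, the two
semiflows control each other:

* `‖J U^(C)_ω(t) u‖ ≤ ‖J‖ ‖U^(C)_ω(t) u‖`, and
* `‖U^(C)_ω(t + 1) u‖ ≤ ‖K_{θ_t ω}‖ ‖J U^(C)_ω(t) u‖`.

The norm of `K_ω` is at most a constant times `exp (2 ∫₀¹ ‖A(θ_r ω)‖ dr)` times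
`1 + ‖B(θ_· ω)‖_{L_q(0,1)}` (`exists_factorization`), so the summability of the coefficients and
the Borel-Cantelli lemma make `‖K_{θ_s ω}‖` subexponential in `s ∈ ℝ` for almost every `ω`
(`ae_subexponential_bound`). Hence `u ∈ C` and `J u ∈ L` have the same finite forward exponential
rates, and the negative semiorbits `v` and `J ∘ v` have the same finite backward rates
(`tendsto_expRate_iff_of_le`). Moreover every negative semiorbit `v` in `L` is `J ∘ x` for a
negative semiorbit in `C`, namely `x(s) = K_{θ_{s-1} ω} v(s - 1)`
(`IsSmoothingExtension.exists_semiorbit`).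

On the other hand an Oseledets decomposition is determined by such rates at almost every `ω`
(`HasExponents`): its exponents are the finite forward rates, and the nonzero elements of `E_i` are
the vectors with rate `λ_i` forward and along some negative semiorbit. So the exponents of the two
decompositions agree, and `J` maps one family of subspaces onto the other
(`IsSmoothingExtension.compare`).

Solutions of the delay equation are obtained as fixed points of a Volterra operator that is a
contraction in the supremum norm with weight `exp (-2 ∫₀ᵗ m)`, with `m` a bound for its kernel
(`integral_mul_exp_primitive_le`, `exists_solvesDelayEquation`); the same weight gives the a priori
estimate from which uniqueness and the boundedness of all operators follow
(`SolvesDelayEquation.norm_le`).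
-/

noncomputable section

namespace DelayRDS

/-! ### An integral inequality for exponential weights -/

/-- A Lipschitz function of an absolutely continuous function is absolutely continuous. -/
theorem absolutelyContinuousOnInterval_lipschitz_comp {f g : ℝ → ℝ} {a b : ℝ} {S : Set ℝ}
    {C : NNReal} (hg : LipschitzOnWith C g S) (hf : AbsolutelyContinuousOnInterval f a b)
    (hS : ∀ x ∈ uIcc a b, f x ∈ S) :
    AbsolutelyContinuousOnInterval (fun x => g (f x)) a b := by
  rw [absolutelyContinuousOnInterval_iff] at hf ⊢
  intro ε hε
  obtain ⟨δ, hδ, h⟩ := hf (ε / (C + 1)) (by positivity)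
  refine ⟨δ, hδ, fun E hE hlt => ?_⟩
  have h1 := h E hE hlt
  have hC : (0 : ℝ) ≤ C := C.2
  calc ∑ i ∈ Finset.range E.1, dist (g (f (E.2 i).1)) (g (f (E.2 i).2))
      ≤ ∑ i ∈ Finset.range E.1, C * dist (f (E.2 i).1) (f (E.2 i).2) := by
        refine Finset.sum_le_sum fun i hi => ?_
        exact hg.dist_le_mul _ (hS _ (hE.1 i hi).1) _
          (hS _ (hE.1 i hi).2)
    _ = C * ∑ i ∈ Finset.range E.1, dist (f (E.2 i).1) (f (E.2 i).2) := by
        rw [Finset.mul_sum]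
    _ ≤ C * (ε / (C + 1)) := by gcongr
    _ < ε := by
        rw [mul_div_assoc', div_lt_iff₀ (by positivity)]
        nlinarith

theorem intervalIntegrable_of_locallyIntegrable {E : Type*} [NormedAddCommGroup E] {m : ℝ → E}
    (hm : LocallyIntegrable m) (s t : ℝ) : IntervalIntegrable m volume s t :=
  (hm.integrableOn_isCompact isCompact_uIcc).intervalIntegrable

theorem locallyIntegrable_norm {E : Type*} [NormedAddCommGroup E] {m : ℝ → E}
    (hm : LocallyIntegrable m) : LocallyIntegrable fun t => ‖m t‖ :=
  hm.mono hm.aestronglyMeasurable.norm (Eventually.of_forall fun _ => by simp)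

theorem monotone_primitive {m : ℝ → ℝ} (hm : LocallyIntegrable m) (h0 : ∀ s, 0 ≤ m s) :
    Monotone fun t => ∫ s in (0 : ℝ)..t, m s := by
  intro x y hxy
  have h := intervalIntegral.integral_add_adjacent_intervals
    (intervalIntegrable_of_locallyIntegrable hm 0 x)
    (intervalIntegrable_of_locallyIntegrable hm x y)
  have h' := intervalIntegral.integral_nonneg hxy (f := m) (μ := volume) fun s _ => h0 s
  simp only
  linarith

theorem continuous_primitive' {m : ℝ → ℝ} (hm : LocallyIntegrable m) :
    Continuous fun t => ∫ s in (0 : ℝ)..t, m s :=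
  intervalIntegral.continuous_primitive (intervalIntegrable_of_locallyIntegrable hm) 0

/-- The weight `exp (2 ∫₀ᵗ m)` absorbs integration against `m`: the Volterra operator with
kernel bounded by `m` is a contraction with constant `1/2` in the norm with this weight. -/
theorem integral_mul_exp_primitive_le {m : ℝ → ℝ} (hm : LocallyIntegrable m) (h0 : ∀ s, 0 ≤ m s)
    {t : ℝ} (ht : 0 ≤ t) :
    ∫ s in (0 : ℝ)..t, m s * Real.exp (2 * ∫ r in (0 : ℝ)..s, m r) ≤
      Real.exp (2 * ∫ r in (0 : ℝ)..t, m r) / 2 := by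
  set F : ℝ → ℝ := fun s => ∫ r in (0 : ℝ)..s, m r with hF
  have hmono : Monotone F := monotone_primitive hm h0
  have hAC : AbsolutelyContinuousOnInterval F 0 t :=
    (intervalIntegrable_of_locallyIntegrable hm 0
      t).absolutelyContinuousOnInterval_intervalIntegral (by simp)
  have hLip : ∃ C : NNReal,
      LipschitzOnWith C (fun x : ℝ => Real.exp (2 * x)) (Icc (F 0) (F t)) := by
    have : ContDiff ℝ 1 (fun x : ℝ => Real.exp (2 * x)) := by fun_prop
    exact this.contDiffOn.exists_lipschitzOnWith (by norm_num) (convex_Icc _ _) isCompact_Icc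
  obtain ⟨C, hC⟩ := hLip
  have hAC2 := absolutelyContinuousOnInterval_lipschitz_comp hC hAC (by
    intro x hx
    rw [uIcc_of_le ht] at hx
    exact ⟨hmono hx.1, hmono hx.2⟩)
  have hd : ∀ᵐ x : ℝ, HasDerivAt F (m x) x := by
    filter_upwards [_root_.LocallyIntegrable.ae_hasDerivAt_integral hm] with x hx using hx 0
  have h1 := hAC2.integral_deriv_eq_sub
  have h2 : ∫ x in (0 : ℝ)..t, deriv (fun x => Real.exp (2 * F x)) x =
      ∫ x in (0 : ℝ)..t, 2 * (m x * Real.exp (2 * F x)) := by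
    refine intervalIntegral.integral_congr_ae ?_
    filter_upwards [hd] with x hx _
    rw [((hx.const_mul 2).exp).deriv]
    ring
  rw [h2, intervalIntegral.integral_const_mul] at h1
  have := Real.exp_pos (2 * F 0)
  linarith

/-! ### Volterra estimates for the delay equation -/

variable {N : ℕ}

/-- Kernel bound of the Volterra operator of the delay equation. The delayed coefficient counts
from time `1` on only: before that the delayed argument is part of the initial data. -/
def kernelBound (a b : ℝ → Vec N →L[ℝ] Vec N) (s : ℝ) : ℝ :=
  ‖a s‖ + (Ici (1 : ℝ)).indicator (fun r => ‖b r‖) s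

theorem kernelBound_nonneg (a b : ℝ → Vec N →L[ℝ] Vec N) (s : ℝ) : 0 ≤ kernelBound a b s :=
  add_nonneg (norm_nonneg _) (indicator_nonneg (fun _ _ => norm_nonneg _) _)

theorem locallyIntegrable_kernelBound {a b : ℝ → Vec N →L[ℝ] Vec N} (ha : LocallyIntegrable a)
    (hb : LocallyIntegrable b) : LocallyIntegrable (kernelBound a b) :=
  (locallyIntegrable_norm ha).add ((locallyIntegrable_norm hb).indicator measurableSet_Ici)

/-- The weight `exp (2 ∫₀ᵗ m)`, where `m` is the kernel bound. -/
def weight (a b : ℝ → Vec N →L[ℝ] Vec N) (t : ℝ) : ℝ :=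
  Real.exp (2 * ∫ s in (0 : ℝ)..t, kernelBound a b s)

theorem weight_pos (a b : ℝ → Vec N →L[ℝ] Vec N) (t : ℝ) : 0 < weight a b t := Real.exp_pos _

theorem weight_mono {a b : ℝ → Vec N →L[ℝ] Vec N} (ha : LocallyIntegrable a)
    (hb : LocallyIntegrable b) : Monotone (weight a b) := fun x y hxy => by
  have := monotone_primitive (locallyIntegrable_kernelBound ha hb) (kernelBound_nonneg a b) hxy
  simp only at this
  unfold weight
  gcongr

theorem one_le_weight {a b : ℝ → Vec N →L[ℝ] Vec N} (ha : LocallyIntegrable a)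
    (hb : LocallyIntegrable b) {t : ℝ} (ht : 0 ≤ t) : 1 ≤ weight a b t := by
  have := weight_mono ha hb ht
  simpa [weight] using this

theorem continuous_weight {a b : ℝ → Vec N →L[ℝ] Vec N} (ha : LocallyIntegrable a)
    (hb : LocallyIntegrable b) : Continuous (weight a b) := by
  have := continuous_primitive' (locallyIntegrable_kernelBound ha hb)
  unfold weight
  fun_prop

theorem integral_kernelBound_mul_weight_le {a b : ℝ → Vec N →L[ℝ] Vec N} (ha : LocallyIntegrable a)
    (hb : LocallyIntegrable b) {t : ℝ} (ht : 0 ≤ t) :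
    ∫ s in (0 : ℝ)..t, kernelBound a b s * weight a b s ≤ weight a b t / 2 :=
  integral_mul_exp_primitive_le (locallyIntegrable_kernelBound ha hb) (kernelBound_nonneg a b) ht

theorem intervalIntegrable_kernelBound_mul_weight {a b : ℝ → Vec N →L[ℝ] Vec N}
    (ha : LocallyIntegrable a)
    (hb : LocallyIntegrable b) (s t : ℝ) :
    IntervalIntegrable (fun s => kernelBound a b s * weight a b s) volume s t :=
  (intervalIntegrable_of_locallyIntegrable
    (locallyIntegrable_kernelBound ha hb) s t).mul_continuousOn
    (continuous_weight ha hb).continuousOn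

/-- On `[0, ∞)` the integral term of the delay equation is controlled by half of the weighted
supremum of `z`, up to the contribution of the initial data. -/
theorem norm_integral_delay_le {a b : ℝ → Vec N →L[ℝ] Vec N} (ha : LocallyIntegrable a)
    (hb : LocallyIntegrable b) {z : ℝ → Vec N} {M t : ℝ} (ht : 0 ≤ t)
    (hz : ∀ s ∈ Icc 0 t, ‖z s‖ ≤ weight a b s * M)
    (hD : IntegrableOn (fun s => ‖b s‖ * ‖z (s - 1)‖) (Ico 0 1)) :
    ‖∫ s in (0 : ℝ)..t, (a s (z s) + b s (z (s - 1)))‖ ≤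
      M * (weight a b t / 2) + ∫ s in Ico (0 : ℝ) 1, ‖b s‖ * ‖z (s - 1)‖ := by
  set e : ℝ → ℝ := (Ico (0 : ℝ) 1).indicator fun s => ‖b s‖ * ‖z (s - 1)‖ with he
  have hM : 0 ≤ M := by
    have := (norm_nonneg _).trans (hz 0 ⟨le_rfl, ht⟩)
    exact nonneg_of_mul_nonneg_right this (weight_pos a b 0)
  have hei : Integrable e := hD.integrable_indicator measurableSet_Ico
  have he0 : ∀ s, 0 ≤ e s := fun s => indicator_nonneg (fun _ _ => by positivity) s
  have hki := (intervalIntegrable_kernelBound_mul_weight ha hb 0 t).const_mul M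
  have h1 : ‖∫ s in (0 : ℝ)..t, (a s (z s) + b s (z (s - 1)))‖ ≤
      ∫ s in (0 : ℝ)..t, (M * (kernelBound a b s * weight a b s) + e s) := by
    refine intervalIntegral.norm_integral_le_of_norm_le ht ?_ (hki.add hei.intervalIntegrable)
    refine Eventually.of_forall fun s hs => (norm_add_le _ _).trans ?_
    have h2 : ‖a s (z s)‖ ≤ ‖a s‖ * (weight a b s * M) :=
      (a s).le_opNorm_of_le (hz s ⟨hs.1.le, hs.2⟩)
    have h3 : ‖b s (z (s - 1))‖ ≤ ‖b s‖ * ‖z (s - 1)‖ := (b s).le_opNorm _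
    by_cases hs1 : s < 1
    · have e1 : e s = ‖b s‖ * ‖z (s - 1)‖ :=
        indicator_of_mem (show s ∈ Ico (0 : ℝ) 1 from ⟨hs.1.le, hs1⟩) _
      have e2 : kernelBound a b s = ‖a s‖ := by simp [kernelBound, hs1]
      rw [e1, e2]
      linarith
    · have e1 : e s = 0 := indicator_of_notMem (fun h => hs1 h.2) _
      have e2 : kernelBound a b s = ‖a s‖ + ‖b s‖ := by simp [kernelBound, not_lt.1 hs1]
      have h4 : ‖z (s - 1)‖ ≤ weight a b s * M := by
        refine (hz (s - 1) ⟨by linarith [not_lt.1 hs1], by linarith [hs.2]⟩).trans ?_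
        gcongr
        exact weight_mono ha hb (by linarith)
      have h5 : ‖b s‖ * ‖z (s - 1)‖ ≤ ‖b s‖ * (weight a b s * M) := by gcongr
      rw [e1, e2]
      linarith
  refine h1.trans ?_
  rw [intervalIntegral.integral_add hki hei.intervalIntegrable,
    intervalIntegral.integral_const_mul]
  gcongr
  · exact integral_kernelBound_mul_weight_le ha hb ht
  · rw [intervalIntegral.integral_of_le ht, ← integral_indicator measurableSet_Ico]
    exact setIntegral_le_integral hei (Eventually.of_forall he0)

/-- A priori estimate for solutions of the delay equation. -/
theorem SolvesDelayEquation.norm_le {a b : ℝ → Vec N →L[ℝ] Vec N} (ha : LocallyIntegrable a)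
    (hb : LocallyIntegrable b) {z : ℝ → Vec N} (hz : SolvesDelayEquation a b z)
    (hD : IntegrableOn (fun s => ‖b s‖ * ‖z (s - 1)‖) (Ico 0 1)) {t : ℝ} (ht : 0 ≤ t) :
    ‖z t‖ ≤ 2 * weight a b t * (‖z 0‖ + ∫ s in Ico (0 : ℝ) 1, ‖b s‖ * ‖z (s - 1)‖) := by
  set D := ∫ s in Ico (0 : ℝ) 1, ‖b s‖ * ‖z (s - 1)‖ with hDdef
  have hD0 : 0 ≤ D := integral_nonneg fun _ => by positivity
  have hcont : ContinuousOn (fun s => (weight a b s)⁻¹ * ‖z s‖) (Icc 0 t) :=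
    ((continuous_weight ha hb).inv₀ fun s => (weight_pos a b s).ne').continuousOn.mul
      (hz.1.norm.mono Icc_subset_Ici_self)
  obtain ⟨s, hs, hmax⟩ := isCompact_Icc.exists_isMaxOn ⟨0, left_mem_Icc.2 ht⟩ hcont
  set M := (weight a b s)⁻¹ * ‖z s‖ with hMdef
  have hM : ∀ r ∈ Icc 0 t, ‖z r‖ ≤ weight a b r * M := fun r hr => by
    have h : (weight a b r)⁻¹ * ‖z r‖ ≤ M := hmax hr
    rwa [inv_mul_le_iff₀ (weight_pos a b r)] at h
  have h1 : ‖z s‖ ≤ ‖z 0‖ + (M * (weight a b s / 2) + D) := by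
    rw [(hz.2 s hs.1).2]
    refine (norm_add_le _ _).trans ?_
    gcongr
    exact norm_integral_delay_le ha hb hs.1 (fun r hr => hM r ⟨hr.1, hr.2.trans hs.2⟩) hD
  have hw := one_le_weight ha hb hs.1
  have hzs : ‖z s‖ = weight a b s * M := by
    rw [hMdef, mul_inv_cancel_left₀ (weight_pos a b s).ne']
  have hM2 : M ≤ 2 * (‖z 0‖ + D) := by
    have h0 := norm_nonneg (z 0)
    by_contra hlt
    push Not at hlt
    nlinarith
  have h2 := hM t ⟨ht, le_rfl⟩
  have := weight_pos a b t
  nlinarith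

theorem locallyIntegrable_clm_apply {c : ℝ → Vec N →L[ℝ] Vec N} (hc : LocallyIntegrable c)
    {f : ℝ → Vec N} (hf : Continuous f) : LocallyIntegrable fun s => c s (f s) := by
  rw [locallyIntegrable_iff]
  intro K hK
  obtain ⟨C, hC⟩ := hK.exists_bound_of_continuousOn hf.continuousOn
  have hi := hc.integrableOn_isCompact hK
  refine Integrable.mono' (hi.norm.mul_const C) ?_ ?_
  · exact (ContinuousLinearMap.apply ℝ (Vec N)).aestronglyMeasurable_comp₂
      hf.aestronglyMeasurable hi.aestronglyMeasurable
  · filter_upwards [ae_restrict_mem hK.measurableSet] with s hs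
    exact (c s).le_opNorm_of_le (hC s hs)

/-- Solutions of the delay equation exist for all initial data whose product with the delayed
coefficient is integrable. -/
theorem exists_solvesDelayEquation {a b : ℝ → Vec N →L[ℝ] Vec N} (ha : LocallyIntegrable a)
    (hb : LocallyIntegrable b) (x₀ : Vec N) (φ : ℝ → Vec N)
    (hφ : IntegrableOn (fun s => b s (φ (s - 1))) (Ico 0 1))
    (hD : IntegrableOn (fun s => ‖b s‖ * ‖φ (s - 1)‖) (Ico 0 1)) :
    ∃ z : ℝ → Vec N, SolvesDelayEquation a b z ∧ z 0 = x₀ ∧ ∀ s < 0, z s = φ s := by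
  have hwc := continuous_weight ha hb
  -- a weighted function `w` on `[0, ∞)` together with the initial data
  let ext (w : BoundedContinuousFunction ℝ (Vec N)) (s : ℝ) : Vec N :=
    if s < 0 then φ s else weight a b s • w s
  let H (w : BoundedContinuousFunction ℝ (Vec N)) (s : ℝ) : Vec N :=
    (Ici (0 : ℝ)).indicator (fun s => a s (weight a b s • w s)) s +
      ((Ico (0 : ℝ) 1).indicator (fun s => b s (φ (s - 1))) s +
        (Ici (1 : ℝ)).indicator (fun s => b s (weight a b (s - 1) • w (s - 1))) s)
  have hH : ∀ w, LocallyIntegrable (H w) := fun w =>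
    ((locallyIntegrable_clm_apply ha (hwc.smul w.continuous)).indicator measurableSet_Ici).add
      ((hφ.integrable_indicator measurableSet_Ico).locallyIntegrable.add
        ((locallyIntegrable_clm_apply hb (f := fun s => weight a b (s - 1) • w (s - 1))
          (by have := w.continuous; fun_prop)).indicator
          measurableSet_Ici))
  have hHeq : ∀ w, ∀ s, 0 ≤ s → H w s = a s (ext w s) + b s (ext w (s - 1)) := by
    intro w s hs
    by_cases h1 : s < 1
    · simp [H, ext, hs, h1, hs.not_gt, not_le.2 h1]
    · have h1' := not_lt.1 h1
      simp [H, ext, hs, h1, hs.not_gt, h1']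
  have hHint : ∀ w t, 0 ≤ t →
      ∫ s in (0 : ℝ)..t, H w s = ∫ s in (0 : ℝ)..t, (a s (ext w s) + b s (ext w (s - 1))) := by
    intro w t ht
    refine intervalIntegral.integral_congr fun s hs => hHeq w s ?_
    rw [uIcc_of_le ht] at hs
    exact hs.1
  have hshift : ∀ w, ∀ s ∈ Ico (0 : ℝ) 1, ext w (s - 1) = φ (s - 1) := fun w s hs => by
    simp [ext, hs.2]
  let f (w : BoundedContinuousFunction ℝ (Vec N)) (t : ℝ) : Vec N :=
    (weight a b (max t 0))⁻¹ • (x₀ + ∫ s in (0 : ℝ)..max t 0, H w s)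
  have hfc : ∀ w, Continuous (f w) := fun w => by
    have h1 : Continuous fun t => ∫ s in (0 : ℝ)..t, H w s :=
      intervalIntegral.continuous_primitive (intervalIntegrable_of_locallyIntegrable (hH w)) 0
    have h2 : Continuous fun t : ℝ => max t 0 := by fun_prop
    exact ((hwc.comp h2).inv₀ fun s => (weight_pos a b _).ne').smul
      (continuous_const.add (h1.comp h2))
  have hfb : ∀ w t, ‖f w t‖ ≤ ‖x₀‖ + (‖w‖ + ∫ s in Ico (0 : ℝ) 1, ‖b s‖ * ‖φ (s - 1)‖) := by
    intro w t
    have ht : 0 ≤ max t 0 := le_max_right _ _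
    have hW := one_le_weight ha hb ht
    have hDe : IntegrableOn (fun s => ‖b s‖ * ‖ext w (s - 1)‖) (Ico 0 1) :=
      hD.congr_fun (fun s hs => by simp only [hshift w s hs]) measurableSet_Ico
    have h1 := norm_integral_delay_le ha hb (z := ext w) (M := ‖w‖) ht (fun s hs => by
      simp only [ext, hs.1.not_gt, if_false, norm_smul, Real.norm_eq_abs,
        abs_of_pos (weight_pos a b s)]
      exact mul_le_mul_of_nonneg_left (w.norm_coe_le_norm s) (weight_pos a b s).le) hDe
    rw [setIntegral_congr_fun measurableSet_Ico
      (g := fun s => ‖b s‖ * ‖φ (s - 1)‖) (fun s hs => by simp only [hshift w s hs]),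
      ← hHint w _ ht] at h1
    have hD0 : 0 ≤ ∫ s in Ico (0 : ℝ) 1, ‖b s‖ * ‖φ (s - 1)‖ :=
      integral_nonneg fun _ => by positivity
    simp only [f, norm_smul, norm_inv, Real.norm_eq_abs, abs_of_pos (weight_pos a b (max t 0))]
    rw [inv_mul_le_iff₀ (weight_pos a b _)]
    refine (norm_add_le _ _).trans ?_
    have := norm_nonneg x₀
    have := norm_nonneg w
    nlinarith
  let F (w : BoundedContinuousFunction ℝ (Vec N)) : BoundedContinuousFunction ℝ (Vec N) :=
    BoundedContinuousFunction.ofNormedAddCommGroup (f w) (hfc w) _ (hfb w)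
  have hF : ContractingWith (1 / 2) F := by
    refine ⟨by norm_num [← NNReal.coe_lt_coe], LipschitzWith.of_dist_le_mul fun w v => ?_⟩
    rw [BoundedContinuousFunction.dist_le (by positivity)]
    intro t
    have ht : 0 ≤ max t 0 := le_max_right _ _
    have hi : ∀ w, IntervalIntegrable (H w) volume 0 (max t 0) := fun w =>
      intervalIntegrable_of_locallyIntegrable (hH w) _ _
    have h0 : ∀ s ∈ Ico (0 : ℝ) 1, ‖b s‖ * ‖ext w (s - 1) - ext v (s - 1)‖ = 0 := fun s hs => by
      rw [hshift w s hs, hshift v s hs]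
      simp
    have h1 := norm_integral_delay_le ha hb (z := fun s => ext w s - ext v s) (M := dist w v) ht
      (fun s hs => by
        simp only [ext, hs.1.not_gt, if_false, ← smul_sub, norm_smul, Real.norm_eq_abs,
          abs_of_pos (weight_pos a b s)]
        refine mul_le_mul_of_nonneg_left ?_ (weight_pos a b s).le
        rw [← dist_eq_norm]
        exact BoundedContinuousFunction.dist_coe_le_dist s)
      ((integrableOn_zero).congr_fun (fun s hs => (h0 s hs).symm) measurableSet_Ico)
    rw [setIntegral_congr_fun measurableSet_Ico h0, integral_zero, add_zero] at h1
    have h2 : ∫ s in (0 : ℝ)..max t 0,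
        (a s (ext w s - ext v s) + b s (ext w (s - 1) - ext v (s - 1))) =
        (∫ s in (0 : ℝ)..max t 0, H w s) - ∫ s in (0 : ℝ)..max t 0, H v s := by
      rw [← intervalIntegral.integral_sub (hi w) (hi v)]
      refine intervalIntegral.integral_congr fun s hs => ?_
      rw [uIcc_of_le ht] at hs
      simp only [hHeq _ s hs.1, map_sub]
      abel
    rw [h2] at h1
    change dist (f w t) (f v t) ≤ _
    simp only [f, dist_eq_norm (_ : Vec N), ← smul_sub, add_sub_add_left_eq_sub, norm_smul,
      norm_inv, Real.norm_eq_abs, abs_of_pos (weight_pos a b (max t 0))]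
    rw [inv_mul_le_iff₀ (weight_pos a b _)]
    refine h1.trans (le_of_eq ?_)
    push_cast
    ring
  set w := ContractingWith.fixedPoint F hF with hw
  have hfix : ∀ t, w t = f w t := fun t => by
    have h : F w = w := hF.fixedPoint_isFixedPt
    conv_lhs => rw [← h]
    rfl
  have hsol : ∀ t, 0 ≤ t → ext w t = x₀ + ∫ s in (0 : ℝ)..t, H w s := by
    intro t ht
    simp only [ext, ht.not_gt, if_false]
    rw [hfix t]
    simp only [f, max_eq_left ht]
    rw [smul_inv_smul₀ (weight_pos a b t).ne']
  have h0 : ext w 0 = x₀ := by simpa using hsol 0 le_rfl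
  refine ⟨ext w, ⟨?_, fun t ht => ⟨?_, ?_⟩⟩, h0, fun s hs => by simp [ext, hs]⟩
  · refine (hwc.smul w.continuous).continuousOn.congr fun s hs => ?_
    simp [ext, not_lt.2 (mem_Ici.1 hs)]
  · refine (intervalIntegrable_of_locallyIntegrable (hH w) 0 t).congr fun s hs => hHeq w s ?_
    rw [uIoc_of_le ht] at hs
    exact hs.1.le
  · rw [h0, hsol t ht, hHint w t ht]

/-! ### Solutions with initial data in `L` -/

/-- The coefficients have the local integrability that makes the delay equation well posed
on `L`. -/
structure Admissible (q : ℝ≥0∞) (a b : ℝ → Vec N →L[ℝ] Vec N) : Prop where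
  locallyIntegrable : LocallyIntegrable a
  memLp : ∀ K : Set ℝ, IsCompact K → MemLp b q (volume.restrict K)

theorem Admissible.locallyIntegrable_delayed {q : ℝ≥0∞} (hq : 1 ≤ q)
    {a b : ℝ → Vec N →L[ℝ] Vec N} (h : Admissible q a b) : LocallyIntegrable b := by
  rw [locallyIntegrable_iff]
  intro K hK
  have : IsFiniteMeasure (volume.restrict K) := ⟨by simpa using hK.measure_lt_top⟩
  exact (h.memLp K hK).integrable hq

theorem map_val_delayMeasure :
    Measure.map Subtype.val delayMeasure = volume.restrict (Icc (-1 : ℝ) 0) := by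
  rw [delayMeasure, (MeasurableEmbedding.subtype_coe measurableSet_Icc).map_comap,
    Subtype.range_coe]

theorem delayMeasure_univ : delayMeasure univ = 1 := by
  rw [delayMeasure, comap_subtype_coe_apply measurableSet_Icc, image_univ, Subtype.range_coe]
  simp

theorem memLp_delay_iff {p : ℝ≥0∞} {f : ℝ → Vec N} :
    MemLp (fun s : DelayInterval => f s) p delayMeasure ↔
      MemLp f p (volume.restrict (Icc (-1 : ℝ) 0)) := by
  rw [← map_val_delayMeasure,
    (MeasurableEmbedding.subtype_coe measurableSet_Icc).memLp_map_measure_iff]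
  rfl

theorem eLpNorm_delay {p : ℝ≥0∞} {f : ℝ → Vec N} :
    eLpNorm (fun s : DelayInterval => f s) p delayMeasure =
      eLpNorm f p (volume.restrict (Icc (-1 : ℝ) 0)) := by
  rw [← map_val_delayMeasure,
    (MeasurableEmbedding.subtype_coe measurableSet_Icc).eLpNorm_map_measure]
  rfl

/-- The `L_q` norm on `[0, 1]` of the delayed coefficient. -/
def delayedNorm (q : ℝ≥0∞) (b : ℝ → Vec N →L[ℝ] Vec N) : ℝ :=
  (eLpNorm b q (volume.restrict (Icc (0 : ℝ) 1))).toReal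

theorem delayedNorm_nonneg (q : ℝ≥0∞) (b : ℝ → Vec N →L[ℝ] Vec N) : 0 ≤ delayedNorm q b :=
  ENNReal.toReal_nonneg

/-- `z` is the solution of the delay equation with initial data `u ∈ L`. -/
structure IsSolutionFrom {p : ℝ≥0∞} (a b : ℝ → Vec N →L[ℝ] Vec N) (u : SpaceL p N)
    (z : ℝ → Vec N) : Prop where
  solves : SolvesDelayEquation a b z
  zero : z 0 = u.fst
  past : ∀ᵐ s : DelayInterval ∂delayMeasure, z s = u.snd s

section

variable {p q : ℝ≥0∞} {a b : ℝ → Vec N →L[ℝ] Vec N} {u v : SpaceL p N} {z w : ℝ → Vec N}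

theorem IsSolutionFrom.memLp_past (hz : IsSolutionFrom a b u z) :
    MemLp z p (volume.restrict (Icc (-1 : ℝ) 0)) := by
  rw [← memLp_delay_iff]
  exact (memLp_congr_ae hz.past).2 (Lp.memLp u.snd)

theorem IsSolutionFrom.eLpNorm_past (hz : IsSolutionFrom a b u z) :
    eLpNorm z p (volume.restrict (Icc (-1 : ℝ) 0)) = ENNReal.ofReal ‖u.snd‖ := by
  rw [← eLpNorm_delay, eLpNorm_congr_ae hz.past, Lp.norm_def, ENNReal.ofReal_toReal]
  exact (Lp.memLp u.snd).2.ne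

/-- Translation of a segment of length one from `[-1, 0)` to `[0, 1)`. -/
theorem measurePreserving_sub_one_restrict :
    MeasurePreserving (fun s : ℝ => s - 1) (volume.restrict (Ico (0 : ℝ) 1))
      (volume.restrict (Ico (-1 : ℝ) 0)) := by
  have h := (measurePreserving_sub_right volume (1 : ℝ)).restrict_preimage
    (measurableSet_Ico (a := (-1 : ℝ)) (b := 0))
  convert! h using 2
  ext s
  simp only [mem_Ico, mem_preimage]
  constructor <;> rintro ⟨h1, h2⟩ <;> constructor <;> linarith

theorem memLp_comp_sub_one (hz : MemLp z p (volume.restrict (Icc (-1 : ℝ) 0))) :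
    MemLp (fun s => z (s - 1)) p (volume.restrict (Ico (0 : ℝ) 1)) ∧
      eLpNorm (fun s => z (s - 1)) p (volume.restrict (Ico (0 : ℝ) 1)) =
        eLpNorm z p (volume.restrict (Icc (-1 : ℝ) 0)) := by
  rw [← restrict_Ico_eq_restrict_Icc] at hz ⊢
  exact ⟨hz.comp_measurePreserving measurePreserving_sub_one_restrict,
    eLpNorm_comp_measurePreserving hz.1 measurePreserving_sub_one_restrict⟩

theorem integrable_delayed_mul [hpq : p.HolderConjugate q] (hab : Admissible q a b)
    (hz : MemLp z p (volume.restrict (Icc (-1 : ℝ) 0))) :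
    IntegrableOn (fun s => ‖b s‖ * ‖z (s - 1)‖) (Ico 0 1) ∧
      IntegrableOn (fun s => b s (z (s - 1))) (Ico 0 1) ∧
      ∫ s in Ico (0 : ℝ) 1, ‖b s‖ * ‖z (s - 1)‖ ≤
        delayedNorm q b * (eLpNorm z p (volume.restrict (Icc (-1 : ℝ) 0))).toReal := by
  obtain ⟨hz1, hz2⟩ := memLp_comp_sub_one hz
  have hb : MemLp b q (volume.restrict (Ico (0 : ℝ) 1)) := by
    rw [restrict_Ico_eq_restrict_Icc]
    exact hab.memLp _ isCompact_Icc
  have h1 : MemLp (fun s => ‖b s‖ * ‖z (s - 1)‖) 1 (volume.restrict (Ico (0 : ℝ) 1)) :=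
    hz1.norm.mul hb.norm
  have h1' : Integrable (fun s => ‖b s‖ * ‖z (s - 1)‖) (volume.restrict (Ico (0 : ℝ) 1)) :=
    memLp_one_iff_integrable.1 h1
  refine ⟨h1', ?_, ?_⟩
  · refine h1'.mono' ?_ (Eventually.of_forall fun s => (b s).le_opNorm _)
    exact (ContinuousLinearMap.apply ℝ (Vec N)).aestronglyMeasurable_comp₂ hz1.1 hb.1
  · have h2 := eLpNorm_smul_le_mul_eLpNorm (p := q) (q := p) (r := 1) hz1.norm.1 hb.norm.1
    rw [eLpNorm_norm, eLpNorm_norm, hz2, restrict_Ico_eq_restrict_Icc] at h2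
    rw [restrict_Ico_eq_restrict_Icc] at hb h1' ⊢
    have h3 : ∫ s in Icc (0 : ℝ) 1, ‖b s‖ * ‖z (s - 1)‖ =
        (eLpNorm ((fun s => ‖b s‖) • fun s => ‖z (s - 1)‖) 1
          (volume.restrict (Icc (0 : ℝ) 1))).toReal := by
      rw [eLpNorm_one_eq_lintegral_enorm, integral_eq_lintegral_of_nonneg_ae
        (Eventually.of_forall fun _ => by positivity) h1'.1]
      congr 1
      refine lintegral_congr fun s => ?_
      rw [← ofReal_norm, Real.norm_of_nonneg]
      · rfl
      · exact mul_nonneg (norm_nonneg _) (norm_nonneg _)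
    rw [h3, delayedNorm, ← ENNReal.toReal_mul]
    exact ENNReal.toReal_mono (ENNReal.mul_ne_top hb.2.ne hz.2.ne) h2

theorem SolvesDelayEquation.add (hz : SolvesDelayEquation a b z) (hw : SolvesDelayEquation a b w) :
    SolvesDelayEquation a b (fun t => z t + w t) := by
  refine ⟨hz.1.add hw.1, fun t ht => ?_⟩
  have h : ∀ s, a s (z s + w s) + b s (z (s - 1) + w (s - 1)) =
      (a s (z s) + b s (z (s - 1))) + (a s (w s) + b s (w (s - 1))) := fun s => by
    simp only [map_add]
    abel
  simp only [h]
  refine ⟨(hz.2 t ht).1.add (hw.2 t ht).1, ?_⟩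
  rw [intervalIntegral.integral_add (hz.2 t ht).1 (hw.2 t ht).1, (hz.2 t ht).2, (hw.2 t ht).2]
  abel

theorem SolvesDelayEquation.const_smul (c : ℝ) (hz : SolvesDelayEquation a b z) :
    SolvesDelayEquation a b (fun t => c • z t) := by
  refine ⟨hz.1.const_smul c, fun t ht => ?_⟩
  simp only [map_smul, ← smul_add]
  refine ⟨(hz.2 t ht).1.smul c, ?_⟩
  rw [intervalIntegral.integral_smul, (hz.2 t ht).2, smul_add]

/-- Shifting time by `t` moves the coefficients along. -/
theorem SolvesDelayEquation.shift (hz : SolvesDelayEquation a b z) {t : ℝ} (ht : 0 ≤ t) :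
    SolvesDelayEquation (fun s => a (t + s)) (fun s => b (t + s)) (fun s => z (t + s)) := by
  refine ⟨hz.1.comp (by fun_prop) fun s hs => add_nonneg ht hs, fun s hs => ?_⟩
  have h1 := hz.2 t ht
  have h2 := hz.2 (t + s) (by positivity)
  have h3 : IntervalIntegrable (fun r => a r (z r) + b r (z (r - 1))) volume t (t + s) :=
    h1.1.symm.trans h2.1
  constructor
  · have := h3.comp_add_left t
    simpa [add_sub_assoc] using this
  · have h4 := intervalIntegral.integral_add_adjacent_intervals h1.1 h3
    have h5 := intervalIntegral.integral_comp_add_left (a := 0) (b := s)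
      (fun r => a r (z r) + b r (z (r - 1))) t
    simp only [add_zero] at h5
    simp only [← add_sub_assoc] at h5 ⊢
    rw [h5, add_zero, h2.2, h1.2, ← h4]
    abel

theorem IsSolutionFrom.add (hz : IsSolutionFrom a b u z) (hw : IsSolutionFrom a b v w) :
    IsSolutionFrom a b (u + v) (fun t => z t + w t) := by
  refine ⟨hz.solves.add hw.solves, by rw [hz.zero, hw.zero]; rfl, ?_⟩
  filter_upwards [hz.past, hw.past, Lp.coeFn_add u.snd v.snd] with s h1 h2 h3
  change _ = (u.snd + v.snd) s
  rw [h3, h1, h2]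
  rfl

theorem IsSolutionFrom.const_smul (c : ℝ) (hz : IsSolutionFrom a b u z) :
    IsSolutionFrom a b (c • u) (fun t => c • z t) := by
  refine ⟨hz.solves.const_smul c, by rw [hz.zero]; rfl, ?_⟩
  filter_upwards [hz.past, Lp.coeFn_smul c u.snd] with s h1 h2
  change _ = (c • u.snd) s
  rw [h2, h1]
  rfl

theorem exists_isSolutionFrom [hpq : p.HolderConjugate q] (hab : Admissible q a b)
    (u : SpaceL p N) : ∃ z, IsSolutionFrom a b u z := by
  have hq : 1 ≤ q := ENNReal.HolderConjugate.one_le q p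
  set φ : ℝ → Vec N := Function.extend Subtype.val (u.snd : DelayInterval → Vec N) 0 with hφ
  have hval : ∀ s : DelayInterval, φ s = u.snd s := fun s =>
    Subtype.val_injective.extend_apply _ _ s
  have hmem : MemLp φ p (volume.restrict (Icc (-1 : ℝ) 0)) := by
    rw [← memLp_delay_iff]
    simp only [hval]
    exact Lp.memLp u.snd
  obtain ⟨h1, h2, -⟩ := integrable_delayed_mul hab hmem
  obtain ⟨z, hz, hz0, hzφ⟩ := exists_solvesDelayEquation hab.locallyIntegrable
    (hab.locallyIntegrable_delayed hq) u.fst φ h2 h1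
  refine ⟨z, hz, hz0, ?_⟩
  have hne : ∀ᵐ s : DelayInterval ∂delayMeasure, s ≠ zeroPt := by
    rw [ae_iff]
    simp only [ne_eq, not_not, ofPred_eq_eq_singleton]
    rw [delayMeasure, comap_subtype_coe_apply measurableSet_Icc, image_singleton]
    simp
  filter_upwards [hne] with s hs
  have hs0 : (s : ℝ) < 0 := lt_of_le_of_ne s.2.2 fun h => hs (Subtype.ext h)
  rw [hzφ s hs0, hval]

variable [Fact (1 ≤ p)]

theorem IsSolutionFrom.norm_le [hpq : p.HolderConjugate q] (hab : Admissible q a b)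
    (hz : IsSolutionFrom a b u z) {t : ℝ} (ht : 0 ≤ t) :
    ‖z t‖ ≤ 2 * weight a b t * (1 + delayedNorm q b) * ‖u‖ := by
  have hq : 1 ≤ q := ENNReal.HolderConjugate.one_le q p
  obtain ⟨h1, -, h3⟩ := integrable_delayed_mul hab hz.memLp_past
  rw [hz.eLpNorm_past, ENNReal.toReal_ofReal (norm_nonneg _)] at h3
  refine (hz.solves.norm_le hab.locallyIntegrable (hab.locallyIntegrable_delayed hq) h1 ht).trans ?_
  rw [hz.zero, mul_assoc (2 * weight a b t)]
  have hw := (weight_pos a b t).le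
  have hβ := delayedNorm_nonneg q b
  refine mul_le_mul_of_nonneg_left ?_ (by positivity)
  have hu : ‖u‖ = ‖u.fst‖ + ‖u.snd‖ := WithLp.prod_norm_eq_of_L1 u
  have := norm_nonneg u.fst
  have := norm_nonneg u.snd
  rw [hu]
  nlinarith

/-- The difference of two solutions with the same initial data has zero initial data, so the
a priori estimate makes it vanish. -/
theorem IsSolutionFrom.unique [hpq : p.HolderConjugate q] (hab : Admissible q a b)
    (hz : IsSolutionFrom a b u z) (hw : IsSolutionFrom a b u w) {t : ℝ} (ht : 0 ≤ t) :
    z t = w t := by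
  have h := ((hz.add (hw.const_smul (-1))).norm_le hab ht)
  have h0 : u + (-1 : ℝ) • u = 0 := by module
  rw [h0, norm_zero, mul_zero] at h
  have := norm_le_zero_iff.1 h
  rw [← sub_eq_zero, ← this]
  module

/-- Segments of solutions are in `L_p`, with a norm bounded by that of the initial data. -/
theorem IsSolutionFrom.memLp_segment [hpq : p.HolderConjugate q]
    (hab : Admissible q a b) (hz : IsSolutionFrom a b u z) {t : ℝ} (ht : 0 ≤ t) :
    MemLp (fun s : DelayInterval => z (t + s)) p delayMeasure ∧
      eLpNorm (fun s : DelayInterval => z (t + s)) p delayMeasure ≤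
        ENNReal.ofReal ((1 + 2 * weight a b t * (1 + delayedNorm q b)) * ‖u‖) := by
  have hq : 1 ≤ q := ENNReal.HolderConjugate.one_le q p
  have hp : 1 ≤ p := Fact.out
  have hemb := MeasurableEmbedding.subtype_coe (measurableSet_Icc (a := (-1 : ℝ)) (b := 0))
  -- split the segment into the part given by the initial data and the part after time `0`
  set g : ℝ → Vec N := (Ico (-1 : ℝ) 0).indicator z with hg
  set h : ℝ → Vec N := (Ici (0 : ℝ)).indicator z with hh
  have hsplit : (fun s : DelayInterval => z (t + s)) =
      fun s : DelayInterval => g (t + s) + h (t + s) := by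
    funext s
    have := s.2.1
    by_cases hs : t + (s : ℝ) < 0
    · rw [hg, hh, indicator_of_mem (show t + (s : ℝ) ∈ Ico (-1 : ℝ) 0 from ⟨by linarith, hs⟩),
        indicator_of_notMem (by simpa using hs), add_zero]
    · rw [hg, hh, indicator_of_notMem (fun h => hs h.2),
        indicator_of_mem (by simpa using hs), zero_add]
  have hpast := hz.memLp_past
  have hnorm := hz.eLpNorm_past
  rw [← restrict_Ico_eq_restrict_Icc] at hpast hnorm
  have hgm : MemLp g p volume := (memLp_indicator_iff_restrict measurableSet_Ico).2 hpast
  have hmp : MeasurePreserving (fun s : ℝ => t + s) volume volume :=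
    measurePreserving_add_left volume t
  have hg1 : MemLp (fun s : DelayInterval => g (t + s)) p delayMeasure := by
    rw [memLp_delay_iff (f := fun s => g (t + s))]
    exact (hgm.comp_measurePreserving hmp).restrict _
  have hg2 : eLpNorm (fun s : DelayInterval => g (t + s)) p delayMeasure ≤
      ENNReal.ofReal ‖u.snd‖ := by
    rw [eLpNorm_delay (f := fun s => g (t + s)), ← hnorm, ← eLpNorm_indicator_eq_eLpNorm_restrict
      measurableSet_Ico, ← eLpNorm_comp_measurePreserving hgm.1 hmp]
    exact eLpNorm_restrict_le _ _ _ _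
  have hhm : AEStronglyMeasurable h volume :=
    (aestronglyMeasurable_indicator_iff measurableSet_Ici).2
      (hz.solves.1.aestronglyMeasurable measurableSet_Ici)
  have hh1 : AEStronglyMeasurable (fun s : DelayInterval => h (t + s)) delayMeasure := by
    refine AEStronglyMeasurable.comp_measurable (g := fun s : ℝ => h (t + s)) ?_
      measurable_subtype_coe
    rw [map_val_delayMeasure]
    exact (hhm.comp_measurePreserving hmp).restrict
  have hw := (weight_pos a b t).le
  have hβ := delayedNorm_nonneg q b
  set c := 2 * weight a b t * (1 + delayedNorm q b) * ‖u‖ with hc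
  have hc0 : 0 ≤ c := by positivity
  have hbd : ∀ s : DelayInterval, ‖h (t + s)‖ ≤ c := by
    intro s
    by_cases hs : 0 ≤ t + (s : ℝ)
    · rw [hh, indicator_of_mem (by simpa using hs)]
      refine (hz.norm_le hab hs).trans ?_
      have := weight_mono hab.locallyIntegrable (hab.locallyIntegrable_delayed hq)
        (show t + (s : ℝ) ≤ t by linarith [s.2.2])
      rw [hc]
      gcongr
    · rw [hh, indicator_of_notMem (by simpa using hs), norm_zero]
      exact hc0
  have hh2 : eLpNorm (fun s : DelayInterval => h (t + s)) p delayMeasure ≤ ENNReal.ofReal c := by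
    have := eLpNorm_le_of_ae_bound (p := p) (μ := delayMeasure)
      (f := fun s : DelayInterval => h (t + s))
      (Eventually.of_forall hbd)
    rwa [delayMeasure_univ, ENNReal.one_rpow, one_mul] at this
  have hle : ‖u.snd‖ ≤ ‖u‖ := by
    have hu : ‖u‖ = ‖u.fst‖ + ‖u.snd‖ := WithLp.prod_norm_eq_of_L1 u
    rw [hu]
    linarith [norm_nonneg u.fst]
  rw [hsplit]
  refine ⟨hg1.add ⟨hh1, hh2.trans_lt ENNReal.ofReal_lt_top⟩, ?_⟩
  refine (eLpNorm_add_le hg1.1 hh1 hp).trans ((add_le_add hg2 hh2).trans ?_)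
  rw [← ENNReal.ofReal_add (norm_nonneg _) hc0]
  refine ENNReal.ofReal_le_ofReal ?_
  rw [hc, add_mul, one_mul]
  linarith

end

/-! ### Solution operators -/

theorem embJ_fst (p : ℝ≥0∞) [Fact (1 ≤ p)] (u : SpaceC N) : (embJ p N u).fst = u zeroPt := rfl

theorem embJ_snd (p : ℝ≥0∞) [Fact (1 ≤ p)] (u : SpaceC N) :
    ((embJ p N u).snd : DelayInterval → Vec N) =ᵐ[delayMeasure] u :=
  ContinuousMap.coeFn_toLp (𝕜 := ℝ) delayMeasure u

instance : delayMeasure.IsOpenPosMeasure := by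
  refine ⟨fun U hU hne => ?_⟩
  rw [isOpen_induced_iff] at hU
  obtain ⟨V, hV, rfl⟩ := hU
  obtain ⟨x, hx⟩ := hne
  rw [delayMeasure, comap_subtype_coe_apply measurableSet_Icc]
  -- an open set that meets `[-1, 0]` meets its interior
  have hx' : (x : ℝ) ∈ closure (Ioo (-1 : ℝ) 0) := by
    rw [closure_Ioo (by norm_num)]
    exact x.2
  obtain ⟨y, hyV, hy⟩ := mem_closure_iff.1 hx' V hV hx
  have hpos : 0 < volume (V ∩ Ioo (-1 : ℝ) 0) :=
    (hV.inter isOpen_Ioo).measure_pos volume ⟨y, hyV, hy⟩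
  refine (hpos.trans_le (measure_mono ?_)).ne'
  rintro r ⟨hrV, hr⟩
  exact ⟨⟨r, hr.1.le, hr.2.le⟩, hrV, rfl⟩

theorem embJ_injective (p : ℝ≥0∞) [Fact (1 ≤ p)] : Function.Injective (embJ p N) := by
  intro u v huv
  have h : (u : DelayInterval → Vec N) =ᵐ[delayMeasure] v := by
    refine (embJ_snd p u).symm.trans ?_
    rw [huv]
    exact embJ_snd p v
  exact DFunLike.coe_injective
    ((Continuous.ae_eq_iff_eq delayMeasure u.continuous v.continuous).1 h)

section

variable {p q : ℝ≥0∞} [Fact (1 ≤ p)] {a b : ℝ → Vec N →L[ℝ] Vec N} {u v : SpaceL p N}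
  {z w : ℝ → Vec N}

theorem IsSolutionFrom.segment_ae_eq [hpq : p.HolderConjugate q] (hab : Admissible q a b)
    (hz : IsSolutionFrom a b u z) (hw : IsSolutionFrom a b u w) {t : ℝ} (ht : 0 ≤ t) :
    ∀ᵐ s : DelayInterval ∂delayMeasure, z (t + s) = w (t + s) := by
  have hp : p ≠ 0 := (zero_lt_one.trans_le (Fact.out : 1 ≤ p)).ne'
  obtain ⟨h1, h2⟩ := (hz.add (hw.const_smul (-1))).memLp_segment hab ht
  have h0 : u + (-1 : ℝ) • u = 0 := by module
  rw [h0, norm_zero, mul_zero, ENNReal.ofReal_zero, nonpos_iff_eq_zero,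
    eLpNorm_eq_zero_iff h1.1 hp] at h2
  filter_upwards [h2] with s hs
  have hs' : z (t + s) + (-1 : ℝ) • w (t + s) = 0 := hs
  rw [← sub_eq_zero, ← hs']
  module

theorem exists_isSolutionOperatorL [hpq : p.HolderConjugate q] (hab : Admissible q a b) {t : ℝ}
    (ht : 0 ≤ t) : ∃ T, IsSolutionOperatorL p a b t T := by
  choose Z hZ using fun u : SpaceL p N => exists_isSolutionFrom hab u
  have hmem := fun u => ((hZ u).memLp_segment hab ht).1
  let T₀ : SpaceL p N →ₗ[ℝ] SpaceL p N :=
    { toFun := fun u => WithLp.toLp 1 (Z u t, (hmem u).toLp _)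
      map_add' := fun u v => by
        have h := (hZ (u + v)).unique hab ((hZ u).add (hZ v)) ht
        have h' := (hZ (u + v)).segment_ae_eq hab ((hZ u).add (hZ v)) ht
        exact congrArg (WithLp.toLp 1) (Prod.ext h ((MemLp.toLp_congr (hmem (u + v))
          ((hmem u).add (hmem v)) h').trans (MemLp.toLp_add (hmem u) (hmem v))))
      map_smul' := fun c u => by
        have h := (hZ (c • u)).unique hab ((hZ u).const_smul c) ht
        have h' := (hZ (c • u)).segment_ae_eq hab ((hZ u).const_smul c) ht
        exact congrArg (WithLp.toLp 1) (Prod.ext h ((MemLp.toLp_congr (hmem (c • u))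
          ((hmem u).const_smul c) h').trans (MemLp.toLp_const_smul c (hmem u)))) }
  have hw := (weight_pos a b t).le
  have hβ := delayedNorm_nonneg q b
  let T := T₀.mkContinuous (2 * weight a b t * (1 + delayedNorm q b) +
      (1 + 2 * weight a b t * (1 + delayedNorm q b))) (fun u => by
    have h : ‖T₀ u‖ = ‖Z u t‖ + ‖(hmem u).toLp _‖ := WithLp.prod_norm_eq_of_L1 (T₀ u)
    rw [h, add_mul]
    refine add_le_add ((hZ u).norm_le hab ht) ?_
    rw [Lp.norm_toLp]
    exact ENNReal.toReal_le_of_le_ofReal (by positivity) ((hZ u).memLp_segment hab ht).2)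
  exact ⟨T, fun u => ⟨Z u, (hZ u).solves, (hZ u).zero, (hZ u).past, rfl, (hmem u).coeFn_toLp⟩⟩

theorem IsSolutionOperatorL.apply_eq [hpq : p.HolderConjugate q] (hab : Admissible q a b) {t : ℝ}
    (ht : 0 ≤ t) {T : SpaceL p N →L[ℝ] SpaceL p N} (hT : IsSolutionOperatorL p a b t T)
    (hz : IsSolutionFrom a b u z) :
    (T u).fst = z t ∧ ∀ᵐ s : DelayInterval ∂delayMeasure, (T u).snd s = z (t + s) := by
  obtain ⟨w, h1, h2, h3, h4, h5⟩ := hT u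
  have hw : IsSolutionFrom a b u w := ⟨h1, h2, h3⟩
  refine ⟨h4.trans (hw.unique hab hz ht), ?_⟩
  filter_upwards [h5, hw.segment_ae_eq hab hz ht] with s hs hs'
  rw [hs, hs']

/-- Solutions with initial data in `C` are continuous on `[-1, ∞)`. -/
theorem SolvesDelayEquation.continuousOn {u : SpaceC N} (hz : SolvesDelayEquation a b z)
    (hu : ∀ s : DelayInterval, z s = u s) : ContinuousOn z (Ici (-1)) := by
  have h1 : ContinuousOn z (Icc (-1) 0) := by
    rw [continuousOn_iff_continuous_domRestrict]
    exact u.continuous.congr fun s => (hu s).symm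
  rw [← Icc_union_Ici_eq_Ici (show (-1 : ℝ) ≤ 0 by norm_num)]
  exact h1.union_of_isClosed hz.1 isClosed_Icc isClosed_Ici

theorem isSolutionFrom_embJ {u : SpaceC N} (hz : SolvesDelayEquation a b z)
    (hu : ∀ s : DelayInterval, z s = u s) : IsSolutionFrom a b (embJ p N u) z := by
  refine ⟨hz, hu zeroPt, ?_⟩
  filter_upwards [embJ_snd p u] with s hs
  rw [hs, hu]

theorem exists_solvesDelayEquation_of_continuous [hpq : p.HolderConjugate q]
    (hab : Admissible q a b) (u : SpaceC N) :
    ∃ z, SolvesDelayEquation a b z ∧ ∀ s : DelayInterval, z s = u s := by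
  have hq : 1 ≤ q := ENNReal.HolderConjugate.one_le q p
  have h01 : (-1 : ℝ) ≤ 0 := by norm_num
  set φ : ℝ → Vec N := IccExtend h01 u with hφ
  have hval : ∀ s : DelayInterval, φ s = u s := fun s => IccExtend_val h01 _ s
  have hmem : MemLp φ p (volume.restrict (Icc (-1 : ℝ) 0)) := by
    rw [← memLp_delay_iff]
    simp only [hval]
    exact (memLp_congr_ae (embJ_snd p u)).1 (Lp.memLp _)
  obtain ⟨h1, h2, -⟩ := integrable_delayed_mul hab hmem
  obtain ⟨z, hz, hz0, hzφ⟩ := exists_solvesDelayEquation hab.locallyIntegrable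
    (hab.locallyIntegrable_delayed hq) (u zeroPt) φ h2 h1
  refine ⟨z, hz, fun s => ?_⟩
  rcases s.2.2.lt_or_eq with hs | hs
  · rw [hzφ s hs, hval]
  · have : s = zeroPt := Subtype.ext hs
    rw [hs, hz0, this]

/-- The segment at time `t` of a function that is continuous on `[-1, ∞)`. -/
def segment (z : ℝ → Vec N) (t : ℝ) (h : ContinuousOn z (Ici (t - 1))) : SpaceC N where
  toFun s := z (t + s)
  continuous_toFun := h.comp_continuous (by fun_prop) fun s => by
    have := s.2.1
    rw [mem_Ici]
    linarith

theorem exists_isSolutionOperatorC [hpq : p.HolderConjugate q] (hab : Admissible q a b) {t : ℝ}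
    (ht : 0 ≤ t) : ∃ T, IsSolutionOperatorC a b t T := by
  have hq : 1 ≤ q := ENNReal.HolderConjugate.one_le q p
  choose Z hZ hZu using fun u : SpaceC N => exists_solvesDelayEquation_of_continuous (p := p) hab u
  have hsol : ∀ u, IsSolutionFrom a b (embJ p N u) (Z u) := fun u =>
    isSolutionFrom_embJ (hZ u) (hZu u)
  have hcont := fun u => ((hZ u).continuousOn (hZu u)).mono
    (Ici_subset_Ici.2 (show (-1 : ℝ) ≤ t - 1 by linarith))
  let T₀ : SpaceC N →ₗ[ℝ] SpaceC N :=
    { toFun := fun u => segment (Z u) t (hcont u)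
      map_add' := fun u v => by
        ext1 s
        change Z (u + v) (t + s) = Z u (t + s) + Z v (t + s)
        rcases le_total 0 (t + (s : ℝ)) with h | h
        · have hs := (hsol u).add (hsol v)
          rw [← map_add] at hs
          exact (hsol (u + v)).unique hab hs h
        · have hmem : t + (s : ℝ) ∈ Icc (-1 : ℝ) 0 := ⟨by linarith [s.2.1], h⟩
          have h1 := hZu (u + v) ⟨_, hmem⟩
          have h2 := hZu u ⟨_, hmem⟩
          have h3 := hZu v ⟨_, hmem⟩
          simp only at h1 h2 h3
          rw [h1, h2, h3]
          rfl
      map_smul' := fun c u => by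
        ext1 s
        change Z (c • u) (t + s) = c • Z u (t + s)
        rcases le_total 0 (t + (s : ℝ)) with h | h
        · have hs := (hsol u).const_smul c
          rw [← map_smul] at hs
          exact (hsol (c • u)).unique hab hs h
        · have hmem : t + (s : ℝ) ∈ Icc (-1 : ℝ) 0 := ⟨by linarith [s.2.1], h⟩
          have h1 := hZu (c • u) ⟨_, hmem⟩
          have h2 := hZu u ⟨_, hmem⟩
          simp only at h1 h2
          rw [h1, h2]
          rfl }
  have hw := (weight_pos a b t).le
  have hβ := delayedNorm_nonneg q b
  set c := 2 * weight a b t * (1 + delayedNorm q b) * ‖embJ p N‖ with hc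
  have hc0 : 0 ≤ c := by positivity
  let T := T₀.mkContinuous (1 + c) (fun u => by
    have h0 := norm_nonneg u
    rw [ContinuousMap.norm_le _ (by positivity)]
    intro s
    change ‖Z u (t + s)‖ ≤ _
    rcases le_total 0 (t + (s : ℝ)) with h | h
    · have h1 := (hsol u).norm_le hab h
      have h2 := weight_mono hab.locallyIntegrable (hab.locallyIntegrable_delayed hq)
        (show t + (s : ℝ) ≤ t by linarith [s.2.2])
      calc ‖Z u (t + s)‖ ≤ 2 * weight a b (t + s) * (1 + delayedNorm q b) * ‖embJ p N u‖ := h1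
        _ ≤ 2 * weight a b t * (1 + delayedNorm q b) * (‖embJ p N‖ * ‖u‖) := by
            gcongr
            exact (embJ p N).le_opNorm u
        _ ≤ (1 + c) * ‖u‖ := by rw [hc]; linarith
    · have h1 := hZu u ⟨t + (s : ℝ), by linarith [s.2.1], h⟩
      simp only at h1
      rw [h1]
      refine (u.norm_coe_le_norm _).trans ?_
      nlinarith)
  exact ⟨T, fun u => ⟨Z u, hZ u, hZu u, fun s => rfl⟩⟩

/-- After one unit of time solutions with initial data in `L` have segments in `C`; the
corresponding operator `L → C` is bounded. -/
theorem exists_smoothingOperator [hpq : p.HolderConjugate q] (hab : Admissible q a b) :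
    ∃ K : SpaceL p N →L[ℝ] SpaceC N, ‖K‖ ≤ 2 * weight a b 1 * (1 + delayedNorm q b) ∧
      ∀ u z, IsSolutionFrom a b u z → ∀ s : DelayInterval, K u s = z (1 + s) := by
  have hq : 1 ≤ q := ENNReal.HolderConjugate.one_le q p
  choose Z hZ using fun u : SpaceL p N => exists_isSolutionFrom hab u
  have hcont : ∀ u, ContinuousOn (Z u) (Ici (1 - 1)) := fun u => by
    rw [sub_self]
    exact (hZ u).solves.1
  have hs0 : ∀ s : DelayInterval, 0 ≤ 1 + (s : ℝ) := fun s => by linarith [s.2.1]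
  let K₀ : SpaceL p N →ₗ[ℝ] SpaceC N :=
    { toFun := fun u => segment (Z u) 1 (hcont u)
      map_add' := fun u v => by
        ext1 s
        exact (hZ (u + v)).unique hab ((hZ u).add (hZ v)) (hs0 s)
      map_smul' := fun c u => by
        ext1 s
        exact (hZ (c • u)).unique hab ((hZ u).const_smul c) (hs0 s) }
  have hw := (weight_pos a b 1).le
  have hβ := delayedNorm_nonneg q b
  refine ⟨K₀.mkContinuous (2 * weight a b 1 * (1 + delayedNorm q b)) (fun u => ?_),
    LinearMap.mkContinuous_norm_le _ (by positivity) _,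
    fun u z hz s => (hZ u).unique hab hz (hs0 s)⟩
  rw [ContinuousMap.norm_le _ (by positivity)]
  intro s
  change ‖Z u (1 + s)‖ ≤ _
  refine ((hZ u).norm_le hab (hs0 s)).trans ?_
  have h2 := weight_mono hab.locallyIntegrable (hab.locallyIntegrable_delayed hq)
    (show 1 + (s : ℝ) ≤ 1 by linarith [s.2.2])
  gcongr

/-- The segments of a solution with initial data in `C` depend continuously on time. -/
theorem IsSolutionOperatorC.continuousOn [hpq : p.HolderConjugate q] (hab : Admissible q a b)
    {T : ℝ → SpaceC N →L[ℝ] SpaceC N} (hT : ∀ t, 0 ≤ t → IsSolutionOperatorC a b t (T t))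
    (u : SpaceC N) : ContinuousOn (fun t => T t u) (Ici 0) := by
  obtain ⟨z, hz, hzu⟩ := exists_solvesDelayEquation_of_continuous (p := p) hab u
  have hT' : ∀ t, 0 ≤ t → ∀ s : DelayInterval, T t u s = z (t + s) := by
    intro t ht s
    obtain ⟨w, hw, hwu, hws⟩ := hT t ht u
    rw [hws s]
    rcases le_total 0 (t + (s : ℝ)) with h | h
    · exact (isSolutionFrom_embJ (p := p) hw hwu).unique hab (isSolutionFrom_embJ hz hzu) h
    · have hmem : t + (s : ℝ) ∈ Icc (-1 : ℝ) 0 := ⟨by linarith [s.2.1], h⟩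
      exact (hwu ⟨_, hmem⟩).trans (hzu ⟨_, hmem⟩).symm
  have hc := hz.continuousOn hzu
  -- the segments form a curve in `C` because `(t, s) ↦ z (t + s)` is jointly continuous
  rw [continuousOn_iff_continuous_domRestrict]
  have hcomp : Continuous fun x : Ici (0 : ℝ) × DelayInterval => z ((x.1 : ℝ) + x.2) :=
    hc.comp_continuous (by fun_prop) fun x => by
      have h1 : (0 : ℝ) ≤ (x.1 : ℝ) := x.1.2
      have h2 := x.2.2.1
      rw [mem_Ici]
      linarith
  refine (ContinuousMap.curry ⟨_, hcomp⟩).continuous.congr fun t => ?_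
  ext1 s
  exact (hT' t t.2 s).symm

end

/-! ### The semiflows on `C` and `L` -/

section

variable {Ω : Type*} [MeasurableSpace Ω] {P : Measure Ω} {θ : ℝ → Ω → Ω}

theorem IsMetricDynamicalSystem.measurable_orbit (hθ : IsMetricDynamicalSystem θ P) (ω : Ω) :
    Measurable fun t => θ t ω :=
  hθ.measurable.comp (measurable_id.prodMk measurable_const)

theorem measurable_matOp {A : Ω → Matrix (Fin N) (Fin N) ℝ}
    (hA : ∀ i j, Measurable fun ω => A ω i j) : StronglyMeasurable fun ω => matOp (A ω) := by
  let f : (Fin N → Fin N → ℝ) →ₗ[ℝ] (Vec N →L[ℝ] Vec N) :=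
    (Matrix.toEuclideanCLM (n := Fin N) (𝕜 := ℝ)).toAlgEquiv.toLinearMap ∘ₗ
      (Matrix.ofLinearEquiv ℝ).toLinearMap
  have hm : Measurable fun ω => (fun i j => A ω i j : Fin N → Fin N → ℝ) :=
    measurable_pi_lambda _ fun i => measurable_pi_lambda _ fun j => hA i j
  exact f.continuous_of_finiteDimensional.comp_stronglyMeasurable hm.stronglyMeasurable

variable {q : ℝ≥0∞} {A B : Ω → Matrix (Fin N) (Fin N) ℝ}

theorem IsRegularPoint.shift (hθ : IsMetricDynamicalSystem θ P) {ω : Ω}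
    (h : IsRegularPoint θ q A B ω) (t : ℝ) : IsRegularPoint θ q A B (θ t ω) := by
  have hmp := measurePreserving_add_left volume t
  have hemb : MeasurableEmbedding fun s : ℝ => t + s := (Homeomorph.addLeft t).measurableEmbedding
  have hpre : ∀ K : Set ℝ, (fun s : ℝ => t + s) ⁻¹' ((fun s : ℝ => t + s) '' K) = K := fun K =>
    preimage_image_eq K (add_right_injective t)
  refine ⟨?_, fun K hK => ?_⟩
  · rw [locallyIntegrable_iff]
    intro K hK
    have h1 := h.1.integrableOn_isCompact (hK.image (continuous_const_add t))
    rw [← hmp.integrableOn_comp_preimage hemb, hpre] at h1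
    refine h1.congr_fun (fun s _ => ?_) hK.measurableSet
    simp only [Function.comp_apply, hθ.add]
  · have h1 := h.2 _ (hK.image (continuous_const_add t))
    have hr := hmp.restrict_preimage_emb hemb ((fun s : ℝ => t + s) '' K)
    rw [hpre] at hr
    have h2 := h1.comp_measurePreserving hr
    simpa only [Function.comp_def, hθ.add] using h2

theorem isRegularPoint_shift_iff (hθ : IsMetricDynamicalSystem θ P) (ω : Ω) (t : ℝ) :
    IsRegularPoint θ q A B (θ t ω) ↔ IsRegularPoint θ q A B ω := by
  refine ⟨fun h => ?_, fun h => h.shift hθ t⟩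
  have := h.shift hθ (-t)
  rwa [← hθ.add, add_neg_cancel, hθ.zero] at this

theorem memLp_const_zero {E : Type*} [NormedAddCommGroup E] (q : ℝ≥0∞) (μ : Measure ℝ) :
    MemLp (fun _ : ℝ => (0 : E)) q μ :=
  MemLp.zero'

/-- Along every orbit the coefficients are admissible. -/
theorem admissible_coeff (hθ : IsMetricDynamicalSystem θ P)
    (hA : ∀ i j, Measurable fun ω => A ω i j) (hB : ∀ i j, Measurable fun ω => B ω i j) (ω : Ω) :
    Admissible q (fun s => coeff θ q A B A (θ s ω)) (fun s => coeff θ q A B B (θ s ω)) := by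
  by_cases h : IsRegularPoint θ q A B ω
  · have h' : ∀ s, IsRegularPoint θ q A B (θ s ω) := h.shift hθ
    simp only [coeff, h', if_true]
    have hmA := (measurable_matOp hA).comp_measurable (hθ.measurable_orbit ω)
    have hmB := (measurable_matOp hB).comp_measurable (hθ.measurable_orbit ω)
    constructor
    · exact h.1.mono hmA.aestronglyMeasurable (Eventually.of_forall fun s => by simp)
    · exact fun K hK => (memLp_norm_iff hmB.aestronglyMeasurable).1 (h.2 K hK)
  · have h' : ∀ s, ¬ IsRegularPoint θ q A B (θ s ω) := fun s => by
      rwa [isRegularPoint_shift_iff hθ]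
    simp only [coeff, h', if_false]
    have h0 : LocallyIntegrable (fun _ : ℝ => (0 : Vec N →L[ℝ] Vec N)) volume :=
      locallyIntegrable_const 0
    have h1 : ∀ K : Set ℝ, MemLp (fun _ : ℝ => (0 : Vec N →L[ℝ] Vec N)) q (volume.restrict K) :=
      fun K => memLp_const_zero q _
    exact ⟨h0, fun K _ => h1 K⟩

theorem norm_coeff_le {Ω : Type*} {θ : ℝ → Ω → Ω} {q : ℝ≥0∞} {A B : Ω → Matrix (Fin N) (Fin N) ℝ}
    (M : Ω → Matrix (Fin N) (Fin N) ℝ) (ω : Ω) :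
    ‖coeff θ q A B M ω‖ ≤ ‖matOp (M ω)‖ := by
  unfold coeff
  split_ifs <;> simp


/-- `p` is not part of the semiflow on `C`; it enters through the integrability of the delayed
coefficient, for which it is the conjugate exponent. -/
theorem semiflowC_spec (p : ℝ≥0∞) [Fact (1 ≤ p)] [hpq : p.HolderConjugate q]
    (hθ : IsMetricDynamicalSystem θ P) (hA : ∀ i j, Measurable fun ω => A ω i j)
    (hB : ∀ i j, Measurable fun ω => B ω i j) {t : ℝ} (ht : 0 ≤ t) (ω : Ω) :
    IsSolutionOperatorC (fun s => coeff θ q A B A (θ s ω)) (fun s => coeff θ q A B B (θ s ω)) t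
      (semiflowC θ q A B t ω) := by
  have h := exists_isSolutionOperatorC (p := p) (admissible_coeff (q := q) hθ hA hB ω) ht
  rw [semiflowC, dif_pos h]
  exact h.choose_spec

theorem semiflowL_spec {p : ℝ≥0∞} [Fact (1 ≤ p)] [hpq : p.HolderConjugate q]
    (hθ : IsMetricDynamicalSystem θ P) (hA : ∀ i j, Measurable fun ω => A ω i j)
    (hB : ∀ i j, Measurable fun ω => B ω i j) {t : ℝ} (ht : 0 ≤ t) (ω : Ω) :
    IsSolutionOperatorL p (fun s => coeff θ q A B A (θ s ω)) (fun s => coeff θ q A B B (θ s ω)) t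
      (semiflowL p θ q A B t ω) := by
  have h := exists_isSolutionOperatorL (p := p) (admissible_coeff (q := q) hθ hA hB ω) ht
  rw [semiflowL, dif_pos h]
  exact h.choose_spec

theorem spaceL_ext {p : ℝ≥0∞} {u v : SpaceL p N} (h1 : u.fst = v.fst)
    (h2 : u.snd =ᵐ[delayMeasure] v.snd) : u = v :=
  WithLp.ofLp_injective 1 (Prod.ext h1 (Lp.ext h2))

theorem semiflowL_apply {p : ℝ≥0∞} [Fact (1 ≤ p)] [hpq : p.HolderConjugate q]
    (hθ : IsMetricDynamicalSystem θ P) (hA : ∀ i j, Measurable fun ω => A ω i j)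
    (hB : ∀ i j, Measurable fun ω => B ω i j) {t : ℝ} (ht : 0 ≤ t) {ω : Ω} {u : SpaceL p N}
    {z : ℝ → Vec N} (hz : IsSolutionFrom (fun s => coeff θ q A B A (θ s ω))
      (fun s => coeff θ q A B B (θ s ω)) u z) :
    (semiflowL p θ q A B t ω u).fst = z t ∧
      ∀ᵐ s : DelayInterval ∂delayMeasure, (semiflowL p θ q A B t ω u).snd s = z (t + s) :=
  (semiflowL_spec hθ hA hB ht ω).apply_eq (admissible_coeff hθ hA hB ω) ht hz

theorem embJ_semiflowC {p : ℝ≥0∞} [Fact (1 ≤ p)] [hpq : p.HolderConjugate q]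
    (hθ : IsMetricDynamicalSystem θ P) (hA : ∀ i j, Measurable fun ω => A ω i j)
    (hB : ∀ i j, Measurable fun ω => B ω i j) {t : ℝ} (ht : 0 ≤ t) (ω : Ω) (u : SpaceC N) :
    embJ p N (semiflowC θ q A B t ω u) = semiflowL p θ q A B t ω (embJ p N u) := by
  obtain ⟨z, hz, hzu, hzt⟩ := semiflowC_spec p (q := q) hθ hA hB ht ω u
  obtain ⟨h1, h2⟩ := semiflowL_apply hθ hA hB ht (isSolutionFrom_embJ (p := p) hz hzu)
  refine spaceL_ext ?_ ?_
  · rw [h1, embJ_fst, hzt]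
    simp [zeroPt]
  · filter_upwards [h2, embJ_snd p (semiflowC θ q A B t ω u)] with s hs hs'
    rw [hs, hs', hzt]

theorem semiflowL_add {p : ℝ≥0∞} [Fact (1 ≤ p)] [hpq : p.HolderConjugate q]
    (hθ : IsMetricDynamicalSystem θ P) (hA : ∀ i j, Measurable fun ω => A ω i j)
    (hB : ∀ i j, Measurable fun ω => B ω i j) {s t : ℝ} (hs : 0 ≤ s) (ht : 0 ≤ t) (ω : Ω)
    (u : SpaceL p N) :
    semiflowL p θ q A B (s + t) ω u =
      semiflowL p θ q A B t (θ s ω) (semiflowL p θ q A B s ω u) := by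
  obtain ⟨z, hz⟩ := exists_isSolutionFrom (admissible_coeff (q := q) hθ hA hB ω) u
  obtain ⟨h1, h2⟩ := semiflowL_apply hθ hA hB hs hz
  obtain ⟨h3, h4⟩ := semiflowL_apply hθ hA hB (add_nonneg hs ht) hz
  have hshift : IsSolutionFrom (fun r => coeff θ q A B A (θ r (θ s ω)))
      (fun r => coeff θ q A B B (θ r (θ s ω))) (semiflowL p θ q A B s ω u)
      (fun r => z (s + r)) := by
    refine ⟨?_, by rw [h1, add_zero], ?_⟩
    · simpa only [hθ.add] using hz.solves.shift hs
    · filter_upwards [h2] with r hr using hr.symm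
  obtain ⟨h5, h6⟩ := semiflowL_apply hθ hA hB ht hshift
  refine spaceL_ext (h3.trans h5.symm) ?_
  filter_upwards [h4, h6] with r hr hr'
  rw [hr, hr', add_assoc]

theorem continuousOn_semiflowC (p : ℝ≥0∞) [Fact (1 ≤ p)] [hpq : p.HolderConjugate q]
    (hθ : IsMetricDynamicalSystem θ P) (hA : ∀ i j, Measurable fun ω => A ω i j)
    (hB : ∀ i j, Measurable fun ω => B ω i j) (ω : Ω) (u : SpaceC N) :
    ContinuousOn (fun t => semiflowC θ q A B t ω u) (Ici 0) :=
  IsSolutionOperatorC.continuousOn (p := p) (admissible_coeff hθ hA hB ω)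
    (T := fun t => semiflowC θ q A B t ω) (fun _ ht => semiflowC_spec p hθ hA hB ht ω) u

/-- The semiflow on `L` at time `1` factors through `C`, with a bound on the factor. -/
theorem exists_factorization {p : ℝ≥0∞} [Fact (1 ≤ p)] [hpq : p.HolderConjugate q]
    (hθ : IsMetricDynamicalSystem θ P) (hA : ∀ i j, Measurable fun ω => A ω i j)
    (hB : ∀ i j, Measurable fun ω => B ω i j) (ω : Ω) :
    ∃ K : SpaceL p N →L[ℝ] SpaceC N,
      (∀ u, embJ p N (K u) = semiflowL p θ q A B 1 ω u) ∧
      ‖K‖ ≤ 2 * weight (fun s => coeff θ q A B A (θ s ω)) (fun s => coeff θ q A B B (θ s ω)) 1 *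
        (1 + delayedNorm q (fun s => coeff θ q A B B (θ s ω))) := by
  obtain ⟨K, hK, hKz⟩ := exists_smoothingOperator (p := p) (admissible_coeff (q := q) hθ hA hB ω)
  refine ⟨K, fun u => ?_, hK⟩
  obtain ⟨z, hz⟩ := exists_isSolutionFrom (admissible_coeff (q := q) hθ hA hB ω) u
  obtain ⟨h1, h2⟩ := semiflowL_apply hθ hA hB zero_le_one hz
  refine spaceL_ext ?_ ?_
  · rw [h1, embJ_fst, hKz u z hz]
    simp [zeroPt]
  · filter_upwards [h2, embJ_snd p (K u)] with s hs hs'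
    rw [hs, hs', hKz u z hz]

end

/-! ### Subexponential growth of the factor along orbits -/

section

variable {Ω : Type*} [MeasurableSpace Ω] {P : Measure Ω} [IsProbabilityMeasure P]
  {θ : ℝ → Ω → Ω}

/-- By the Borel-Cantelli lemma, an integrable function grows sublinearly along a sequence of
measure preserving maps. -/
theorem ae_eventually_le_of_integrable {X : Ω → ℝ} (hX : Integrable X P) (hm : Measurable X)
    (h0 : 0 ≤ X) {T : ℕ → Ω → Ω} (hT : ∀ n, MeasurePreserving (T n) P P) :
    ∀ᵐ ω ∂P, ∀ᶠ n : ℕ in atTop, X (T n ω) ≤ n := by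
  have h := @ProbabilityTheory.tsum_prob_mem_Ioi_lt_top Ω ⟨P⟩ ‹_› X hX h0
  have h' : ∑' n : ℕ, P (T n ⁻¹' (X ⁻¹' Ioi (n : ℝ))) ≠ ⊤ := by
    have : ∀ n : ℕ, P (T n ⁻¹' (X ⁻¹' Ioi (n : ℝ))) = P (X ⁻¹' Ioi (n : ℝ)) := fun n =>
      (hT n).measure_preimage (hm measurableSet_Ioi).nullMeasurableSet
    simp only [this]
    exact h.ne
  filter_upwards [ae_eventually_notMem h'] with ω hω
  filter_upwards [hω] with n hn
  simpa using hn

theorem exists_le_add_of_eventually_le {f g : ℕ → ℝ} (h : ∀ᶠ n in atTop, f n ≤ g n) :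
    ∃ C : ℝ, 0 ≤ C ∧ ∀ n, f n ≤ C + g n := by
  obtain ⟨M, hM⟩ := eventually_atTop.1 h
  refine ⟨∑ n ∈ Finset.range M, |f n - g n|, Finset.sum_nonneg fun _ _ => abs_nonneg _,
    fun n => ?_⟩
  have h0 : 0 ≤ ∑ n ∈ Finset.range M, |f n - g n| := Finset.sum_nonneg fun _ _ => abs_nonneg _
  rcases lt_or_ge n M with hn | hn
  · have h1 := Finset.single_le_sum (f := fun n => |f n - g n|) (fun _ _ => abs_nonneg _)
      (Finset.mem_range.2 hn)
    have h2 := le_abs_self (f n - g n)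
    linarith
  · linarith [hM n hn]

/-- Integrable functions grow sublinearly along almost every orbit. -/
theorem ae_sublinear_along_orbit (hθ : IsMetricDynamicalSystem θ P) {h : Ω → ℝ≥0∞}
    (hm : Measurable h) (hi : ∫⁻ ω, h ω ∂P ≠ ⊤) :
    ∀ᵐ ω ∂P, ∀ ε > (0 : ℝ), ∃ C : ℝ, 0 ≤ C ∧
      ∀ n : ℤ, h (θ n ω) ≤ ENNReal.ofReal (C + ε * |(n : ℝ)|) := by
  have hfin : ∀ᵐ ω ∂P, ∀ n : ℤ, h (θ n ω) < ⊤ := by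
    rw [ae_all_iff]
    exact fun n => (hθ.preserving n).quasiMeasurePreserving.ae (ae_lt_top hm hi)
  have hseq : ∀ᵐ ω ∂P, ∀ k : ℕ, (∀ᶠ n : ℕ in atTop, (k + 1) * (h (θ n ω)).toReal ≤ n) ∧
      ∀ᶠ n : ℕ in atTop, (k + 1) * (h (θ (-n) ω)).toReal ≤ n := by
    rw [ae_all_iff]
    intro k
    have h1 : Integrable (fun ω => ((k : ℝ) + 1) * (h ω).toReal) P :=
      (integrable_toReal_of_lintegral_ne_top hm.aemeasurable hi).const_mul _
    have h2 : Measurable (fun ω => ((k : ℝ) + 1) * (h ω).toReal) := hm.ennreal_toReal.const_mul _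
    have h3 : 0 ≤ fun ω => ((k : ℝ) + 1) * (h ω).toReal := fun ω => by
      change (0 : ℝ) ≤ _
      positivity
    filter_upwards [ae_eventually_le_of_integrable h1 h2 h3 (T := fun n => θ n)
        (fun n => hθ.preserving n),
      ae_eventually_le_of_integrable h1 h2 h3 (T := fun n => θ (-n)) (fun n => hθ.preserving (-n))]
      with ω ha hb using ⟨ha, hb⟩
  filter_upwards [hfin, hseq] with ω hf hs ε hε
  obtain ⟨k, hk⟩ := exists_nat_one_div_lt hε
  have hk1 : (0 : ℝ) < k + 1 := by positivity
  have hconv : ∀ x : ℝ, ∀ n : ℕ, (k + 1) * x ≤ n → x ≤ ε * n := by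
    intro x n hx
    have h1 : x ≤ 1 / (k + 1) * n := by
      rw [one_div, le_inv_mul_iff₀ hk1]
      exact hx
    exact h1.trans (by gcongr)
  obtain ⟨C₁, hC₁, h₁⟩ := exists_le_add_of_eventually_le
    ((hs k).1.mono fun n hn => hconv _ n hn)
  obtain ⟨C₂, hC₂, h₂⟩ := exists_le_add_of_eventually_le
    ((hs k).2.mono fun n hn => hconv _ n hn)
  refine ⟨C₁ + C₂, by positivity, fun n => ?_⟩
  rw [← ENNReal.ofReal_toReal (hf n).ne]
  refine ENNReal.ofReal_le_ofReal ?_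
  obtain ⟨m, rfl | rfl⟩ := n.eq_nat_or_neg
  · have := h₁ m
    push_cast
    rw [Nat.abs_cast]
    linarith
  · have := h₂ m
    push_cast
    rw [abs_neg, Nat.abs_cast]
    linarith

/-- An integral over a unit interval is bounded by the integrals over the two neighbouring unit
intervals with integer end points. -/
theorem lintegral_unit_le (f : ℝ → ℝ≥0∞) (s : ℝ) :
    ∫⁻ r in Icc (0 : ℝ) 1, f (s + r) ≤
      (∫⁻ r in Icc (0 : ℝ) 1, f (⌊s⌋ + r)) + ∫⁻ r in Icc (0 : ℝ) 1, f ((⌊s⌋ + 1 : ℤ) + r) := by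
  have key : ∀ s : ℝ, ∫⁻ r in Icc (0 : ℝ) 1, f (s + r) = ∫⁻ r in Icc s (s + 1), f r := by
    intro s
    rw [(measurePreserving_add_left volume s).setLIntegral_comp_emb
      (Homeomorph.addLeft s).measurableEmbedding f]
    simp [add_comm]
  rw [key, key, key]
  refine le_trans (lintegral_mono_set ?_) (lintegral_union_le f _ _)
  intro r hr
  have h1 := Int.floor_le s
  have h2 := Int.lt_floor_add_one s
  push_cast
  rcases le_total r (⌊s⌋ + 1) with h | h
  · exact Or.inl ⟨h1.trans hr.1, h⟩
  · exact Or.inr ⟨h, by linarith [hr.2]⟩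

variable {q : ℝ≥0∞} {A B : Ω → Matrix (Fin N) (Fin N) ℝ}

/-- Up to time `1` the delayed coefficient does not enter the weight. This is why the factor
`L → C` depends exponentially only on the undelayed coefficient. -/
theorem weight_one_le {a b : ℝ → Vec N →L[ℝ] Vec N} (ha : LocallyIntegrable a) {x : ℝ} (hx : 0 ≤ x)
    (h : ∫⁻ r in Icc (0 : ℝ) 1, ‖a r‖ₑ ≤ ENNReal.ofReal x) :
    weight a b 1 ≤ Real.exp (2 * x) := by
  have hk : ∫ s in (0 : ℝ)..1, kernelBound a b s = ∫ s in (0 : ℝ)..1, ‖a s‖ := by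
    refine intervalIntegral.integral_congr_ae ?_
    have hne : ∀ᵐ s : ℝ, s ≠ 1 := by simp [ae_iff]
    filter_upwards [hne] with s hs hs'
    rw [uIoc_of_le zero_le_one] at hs'
    simp [kernelBound, lt_of_le_of_ne hs'.2 hs]
  have hint : ∫ s in (0 : ℝ)..1, ‖a s‖ ≤ x := by
    rw [intervalIntegral.integral_of_le zero_le_one, ← integral_Icc_eq_integral_Ioc,
      integral_norm_eq_lintegral_enorm (ha.aestronglyMeasurable.restrict)]
    exact ENNReal.toReal_le_of_le_ofReal hx h
  rw [weight, hk]
  gcongr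

/-- For a bound `x ≥ 1` of the integral of `‖b‖ ^ q` the root may be dropped. -/
theorem delayedNorm_le {b : ℝ → Vec N →L[ℝ] Vec N} (hq : 1 ≤ q) (hq' : q ≠ ⊤) {x : ℝ} (hx : 1 ≤ x)
    (h : ∫⁻ r in Icc (0 : ℝ) 1, ‖b r‖ₑ ^ q.toReal ≤ ENNReal.ofReal x) :
    delayedNorm q b ≤ x := by
  have hq0 : q ≠ 0 := (zero_lt_one.trans_le hq).ne'
  have hq1 : 1 ≤ q.toReal := by
    rw [← ENNReal.toReal_one]
    exact ENNReal.toReal_mono hq' hq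
  rw [delayedNorm, eLpNorm_eq_lintegral_rpow_enorm_toReal hq0 hq']
  refine ENNReal.toReal_le_of_le_ofReal (zero_le_one.trans hx) ?_
  have hx' : 1 ≤ ENNReal.ofReal x := by simpa using hx
  calc (∫⁻ r in Icc (0 : ℝ) 1, ‖b r‖ₑ ^ q.toReal) ^ (1 / q.toReal)
      ≤ ENNReal.ofReal x ^ (1 / q.toReal) := by gcongr
    _ ≤ ENNReal.ofReal x ^ (1 : ℝ) := by
        refine ENNReal.rpow_le_rpow_of_exponent_le hx' ?_
        rw [div_le_one (by linarith)]
        exact hq1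
    _ = ENNReal.ofReal x := ENNReal.rpow_one _

/-- `EReal.toENNReal` is the positive part, so this turns a bound on `ln⁺ x` into one on `x`. -/
theorem le_exp_of_toENNReal_log_le {x : ℝ≥0∞} {c : ℝ} (hc : 0 ≤ c)
    (h : (ENNReal.log x).toENNReal ≤ ENNReal.ofReal c) : x ≤ ENNReal.ofReal (Real.exp c) := by
  have h1 : ENNReal.log x ≤ (c : EReal) := by
    calc ENNReal.log x ≤ ((ENNReal.log x).toENNReal : EReal) := by
          rw [EReal.coe_toENNReal_eq_max]
          exact le_max_right _ _
      _ ≤ (ENNReal.ofReal c : EReal) := EReal.coe_ennreal_le_coe_ennreal_iff.2 h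
      _ = (c : EReal) := by
          rw [EReal.coe_ennreal_ofReal, max_eq_left hc]
  rw [← ENNReal.log_le_log_iff, ENNReal.log_ofReal_of_pos (Real.exp_pos c), Real.log_exp]
  exact h1

/-- The bound of the factor `L → C` of the solution operator at time `1` grows subexponentially
along almost every orbit. -/
theorem ae_subexponential_bound (hθ : IsMetricDynamicalSystem θ P)
    (hA : ∀ i j, Measurable fun ω => A ω i j) (hB : ∀ i j, Measurable fun ω => B ω i j)
    (hq : 1 ≤ q) (hq' : q ≠ ⊤) (hAB : IsSummableCoefficients θ P q A B) :
    ∀ᵐ ω ∂P, ∀ ε > (0 : ℝ), ∃ C : ℝ, 0 ≤ C ∧ ∀ s : ℝ,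
      2 * weight (fun r => coeff θ q A B A (θ r (θ s ω)))
          (fun r => coeff θ q A B B (θ r (θ s ω))) 1 *
        (1 + delayedNorm q (fun r => coeff θ q A B B (θ r (θ s ω)))) ≤
      C * Real.exp (ε * |s|) := by
  have hmA := (measurable_matOp hA).enorm
  have hmB := (measurable_matOp hB).enorm
  have hflow : Measurable fun x : Ω × ℝ => θ x.2 x.1 := hθ.measurable.comp measurable_swap
  set XA : Ω → ℝ≥0∞ := fun ω => ∫⁻ r in Icc (0 : ℝ) 1, ‖matOp (A (θ r ω))‖ₑ with hXA
  set XB : Ω → ℝ≥0∞ := fun ω => ∫⁻ r in Icc (0 : ℝ) 1, ‖matOp (B (θ r ω))‖ₑ ^ q.toReal with hXB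
  have hXAm : Measurable XA :=
    Measurable.lintegral_prod_right' (ν := volume.restrict (Icc (0 : ℝ) 1))
    (f := fun x : Ω × ℝ => ‖matOp (A (θ x.2 x.1))‖ₑ) (hmA.comp hflow)
  have hXBm : Measurable XB :=
    Measurable.lintegral_prod_right' (ν := volume.restrict (Icc (0 : ℝ) 1))
    (f := fun x : Ω × ℝ => ‖matOp (B (θ x.2 x.1))‖ₑ ^ q.toReal) ((hmB.comp hflow).pow_const _)
  have hXAi : ∫⁻ ω, XA ω ∂P ≠ ⊤ := by
    rw [hXA, lintegral_lintegral_swap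
      (f := fun ω r => ‖matOp (A (θ r ω))‖ₑ) (hmA.comp hflow).aemeasurable]
    have : ∀ r : ℝ, ∫⁻ ω, ‖matOp (A (θ r ω))‖ₑ ∂P = ∫⁻ ω, ‖matOp (A ω)‖ₑ ∂P := fun r =>
      (hθ.preserving r).lintegral_comp hmA
    simp only [this, lintegral_const, Measure.restrict_apply MeasurableSet.univ, univ_inter,
      Real.volume_Icc, sub_zero, ENNReal.ofReal_one, mul_one]
    have := hAB.1.2
    rw [hasFiniteIntegral_iff_enorm] at this
    simpa using this.ne
  have hB' := ae_sublinear_along_orbit hθ (h := fun ω => (ENNReal.log (XB ω)).toENNReal)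
    (measurable_ereal_toENNReal.comp hXBm.ennreal_log) hAB.2.ne
  filter_upwards [ae_sublinear_along_orbit hθ hXAm hXAi, hB'] with ω hωA hωB ε hε
  obtain ⟨CA, hCA, hA1⟩ := hωA (ε / 5) (by positivity)
  obtain ⟨CB, hCB, hB1⟩ := hωB (ε / 5) (by positivity)
  set c := CA + CB + ε / 5 with hc
  refine ⟨8 * Real.exp (5 * c), by positivity, fun s => ?_⟩
  -- the integers next to `s` are at most `|s| + 1` in absolute value
  have hfl : |((⌊s⌋ : ℤ) : ℝ)| ≤ |s| + 1 ∧ |((⌊s⌋ + 1 : ℤ) : ℝ)| ≤ |s| + 1 := by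
    have h1 := Int.floor_le s
    have h2 := Int.lt_floor_add_one s
    have h3 := neg_abs_le s
    have h4 := le_abs_self s
    push_cast
    constructor <;> rw [abs_le] <;> constructor <;> linarith
  set y := c + ε / 5 * |s| with hy
  have hy0 : 0 ≤ y := by positivity
  have hbd : ∀ n : ℤ, |(n : ℝ)| ≤ |s| + 1 →
      CA + ε / 5 * |(n : ℝ)| ≤ y ∧ CB + ε / 5 * |(n : ℝ)| ≤ y := by
    intro n hn
    have : ε / 5 * |(n : ℝ)| ≤ ε / 5 * (|s| + 1) := by gcongr
    constructor <;> linarith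
  have hA2 : ∀ n : ℤ, |(n : ℝ)| ≤ |s| + 1 → XA (θ n ω) ≤ ENNReal.ofReal y := fun n hn =>
    (hA1 n).trans (ENNReal.ofReal_le_ofReal (hbd n hn).1)
  have hB2 : ∀ n : ℤ, |(n : ℝ)| ≤ |s| + 1 → XB (θ n ω) ≤ ENNReal.ofReal (Real.exp y) := fun n hn =>
    le_exp_of_toENNReal_log_le hy0 ((hB1 n).trans (ENNReal.ofReal_le_ofReal (hbd n hn).2))
  have hA3 : XA (θ s ω) ≤ ENNReal.ofReal (2 * y) := by
    have h := lintegral_unit_le (fun r => ‖matOp (A (θ r ω))‖ₑ) s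
    simp only [hθ.add] at h
    refine h.trans ((add_le_add (hA2 _ hfl.1) (hA2 _ hfl.2)).trans_eq ?_)
    rw [← ENNReal.ofReal_add hy0 hy0, two_mul]
  have hB3 : XB (θ s ω) ≤ ENNReal.ofReal (2 * Real.exp y) := by
    have h := lintegral_unit_le (fun r => ‖matOp (B (θ r ω))‖ₑ ^ q.toReal) s
    simp only [hθ.add] at h
    refine h.trans ((add_le_add (hB2 _ hfl.1) (hB2 _ hfl.2)).trans_eq ?_)
    rw [← ENNReal.ofReal_add (Real.exp_pos _).le (Real.exp_pos _).le, two_mul]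
  have hle : ∀ (M : Ω → Matrix (Fin N) (Fin N) ℝ) (η : Ω),
      ‖coeff θ q A B M η‖ₑ ≤ ‖matOp (M η)‖ₑ := fun M η =>
    enorm_le_iff_norm_le.2 (norm_coeff_le M η)
  have hadm := admissible_coeff (q := q) hθ hA hB (θ s ω)
  have hw := weight_one_le (b := fun r => coeff θ q A B B (θ r (θ s ω)))
    hadm.locallyIntegrable (by positivity : 0 ≤ 2 * y)
    ((lintegral_mono fun r => hle A _).trans hA3)
  have he1 : 1 ≤ Real.exp y := Real.one_le_exp hy0
  have hd := delayedNorm_le (b := fun r => coeff θ q A B B (θ r (θ s ω))) hq hq'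
    (by linarith : 1 ≤ 2 * Real.exp y)
    ((lintegral_mono fun r => by gcongr; exact hle B _).trans hB3)
  calc _ ≤ 2 * Real.exp (2 * (2 * y)) * (1 + 2 * Real.exp y) := by
        have := delayedNorm_nonneg q (fun r => coeff θ q A B B (θ r (θ s ω)))
        gcongr
    _ ≤ 2 * Real.exp (2 * (2 * y)) * (4 * Real.exp y) := by gcongr; linarith
    _ = 8 * (Real.exp (2 * (2 * y)) * Real.exp y) := by ring
    _ = 8 * Real.exp (2 * (2 * y) + y) := by rw [← Real.exp_add]
    _ = 8 * Real.exp (5 * c) * Real.exp (ε * |s|) := by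
        rw [mul_assoc, ← Real.exp_add]
        congr 2
        rw [hy]
        ring

end

/-! ### Exponential rates -/

section

variable {X Y : Type*} [NormedAddCommGroup X] [NormedAddCommGroup Y] {l : Filter ℝ}

theorem expRate_enorm {x : X} (hx : x ≠ 0) (t : ℝ) :
    expRate ‖x‖ₑ t = ((Real.log ‖x‖ / t : ℝ) : EReal) := by
  rw [expRate, ← ofReal_norm, ENNReal.log_ofReal_of_pos (norm_pos_iff.2 hx), EReal.coe_div]

/-- A finite exponential rate means `ln ‖f t‖ = r t + o(t)`. -/
theorem tendsto_expRate_iff (hl : Tendsto (fun t : ℝ => |t|) l atTop) {f : ℝ → X} {r : ℝ} :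
    Tendsto (fun t => expRate ‖f t‖ₑ t) l (𝓝 (r : EReal)) ↔
      (∀ᶠ t in l, f t ≠ 0) ∧ ∀ δ > 0, ∀ᶠ t in l, |Real.log ‖f t‖ - r * t| ≤ δ * |t| := by
  have ht0 : ∀ᶠ t : ℝ in l, t ≠ 0 := by
    filter_upwards [hl.eventually_gt_atTop 0] with t ht using abs_pos.1 ht
  have key : (∀ᶠ t in l, f t ≠ 0) → (Tendsto (fun t => expRate ‖f t‖ₑ t) l (𝓝 (r : EReal)) ↔
      ∀ δ > 0, ∀ᶠ t in l, |Real.log ‖f t‖ - r * t| ≤ δ * |t|) := by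
    intro hf
    have h1 : (fun t => expRate ‖f t‖ₑ t) =ᶠ[l] fun t => ((Real.log ‖f t‖ / t : ℝ) : EReal) := by
      filter_upwards [hf] with t h using expRate_enorm h t
    rw [tendsto_congr' h1, EReal.tendsto_coe, ← tendsto_sub_nhds_zero_iff,
      ← Asymptotics.isLittleO_one_iff (F := ℝ), Asymptotics.isLittleO_iff]
    refine forall₂_congr fun δ hδ => eventually_congr ?_
    filter_upwards [ht0] with t ht
    have h2 : Real.log ‖f t‖ / t - r = (Real.log ‖f t‖ - r * t) / t := by field_simp
    rw [h2, Real.norm_eq_abs, abs_div, norm_one, mul_one, div_le_iff₀ (abs_pos.2 ht)]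
  refine ⟨fun h => ?_, fun h => (key h.1).2 h.2⟩
  have hf : ∀ᶠ t in l, f t ≠ 0 := by
    filter_upwards [h.eventually_ne (EReal.coe_ne_bot r), h.eventually_ne (EReal.coe_ne_top r),
      ht0] with t h1 h2 ht h0
    rcases lt_or_gt_of_ne ht with ht | ht
    · apply h2
      simp [expRate, h0, EReal.bot_div_of_neg_ne_bot (EReal.coe_neg'.2 ht) (EReal.coe_ne_bot t)]
    · apply h1
      simp [expRate, h0, EReal.bot_div_of_pos_ne_top (EReal.coe_pos.2 ht) (EReal.coe_ne_top t)]
  exact ⟨hf, (key hf).1 h⟩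

/-- Finite exponential rates are insensitive to subexponential factors and to translations in
time. -/
theorem tendsto_expRate_of_le (hl : Tendsto (fun t : ℝ => |t|) l atTop)
    (hadd : ∀ a : ℝ, Tendsto (fun t => t + a) l l) {f : ℝ → X} {g : ℝ → Y} (a b : ℝ)
    (hgf : ∀ ε > (0 : ℝ), ∃ C : ℝ, ∀ᶠ t in l, ‖g t‖ ≤ C * Real.exp (ε * |t|) * ‖f (t + a)‖)
    (hfg : ∀ ε > (0 : ℝ), ∃ C : ℝ, ∀ᶠ t in l, ‖f (t + b)‖ ≤ C * Real.exp (ε * |t|) * ‖g t‖)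
    {r : ℝ} (h : Tendsto (fun t => expRate ‖f t‖ₑ t) l (𝓝 (r : EReal))) :
    Tendsto (fun t => expRate ‖g t‖ₑ t) l (𝓝 (r : EReal)) := by
  rw [tendsto_expRate_iff hl] at h ⊢
  obtain ⟨hf, hr⟩ := h
  have hg : ∀ᶠ t in l, g t ≠ 0 := by
    obtain ⟨C, hC⟩ := hfg 1 one_pos
    filter_upwards [(hadd b).eventually hf, hC] with t h1 h2 h0
    rw [h0, norm_zero, mul_zero] at h2
    exact h1 (norm_le_zero_iff.1 h2)
  refine ⟨hg, fun δ hδ => ?_⟩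
  obtain ⟨C₁, hC₁⟩ := hgf (δ / 4) (by positivity)
  obtain ⟨C₂, hC₂⟩ := hfg (δ / 4) (by positivity)
  have hlog : ∀ {x y C ε t : ℝ}, 0 < x → 0 < y → x ≤ C * Real.exp (ε * |t|) * y →
      Real.log x ≤ Real.log (max C 1) + ε * |t| + Real.log y := by
    intro x y C ε t hx hy hxy
    have hm : 0 < max C 1 := zero_lt_one.trans_le (le_max_right _ _)
    have h1 : x ≤ max C 1 * Real.exp (ε * |t|) * y := hxy.trans (by gcongr; exact le_max_left _ _)
    have h2 := Real.log_le_log hx h1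
    rwa [Real.log_mul (by positivity) hy.ne', Real.log_mul hm.ne' (Real.exp_pos _).ne',
      Real.log_exp] at h2
  set c := |Real.log (max C₁ 1)| + |Real.log (max C₂ 1)| + |r * a| + |r * b| +
    δ / 4 * (|a| + |b|) with hc
  filter_upwards [hg, (hadd a).eventually hf, (hadd b).eventually hf, hC₁, hC₂,
    (hadd a).eventually (hr (δ / 4) (by positivity)),
    (hadd b).eventually (hr (δ / 4) (by positivity)),
    hl.eventually_ge_atTop (c / (δ / 4))] with t hgt hfa hfb h1 h2 h3 h4 h5
  have h6 := hlog (norm_pos_iff.2 hgt) (norm_pos_iff.2 hfa) h1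
  have h7 := hlog (norm_pos_iff.2 hfb) (norm_pos_iff.2 hgt) h2
  rw [div_le_iff₀ (by positivity)] at h5
  have ha : δ / 4 * |t + a| ≤ δ / 4 * (|t| + |a|) := by
    gcongr
    exact abs_add_le t a
  have hb : δ / 4 * |t + b| ≤ δ / 4 * (|t| + |b|) := by
    gcongr
    exact abs_add_le t b
  have h3' := abs_le.1 h3
  have h4' := abs_le.1 h4
  have e1 := le_abs_self (Real.log (max C₁ 1))
  have e2 := le_abs_self (Real.log (max C₂ 1))
  have e3 := abs_le.1 (le_refl |r * a|)
  have e4 := abs_le.1 (le_refl |r * b|)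
  have e5 := abs_nonneg (Real.log (max C₁ 1))
  have e6 := abs_nonneg (Real.log (max C₂ 1))
  have e7 : 0 ≤ δ / 4 * |a| := by positivity
  have e8 : 0 ≤ δ / 4 * |b| := by positivity
  rw [abs_le]
  constructor <;> nlinarith

/-- If `g` is bounded by `f` and controls `f` one unit of time later up to subexponential
factors, then `f` and `g` have the same finite exponential rates. -/
theorem tendsto_expRate_iff_of_le (hl : Tendsto (fun t : ℝ => |t|) l atTop)
    (hadd : ∀ a : ℝ, Tendsto (fun t => t + a) l l) {f : ℝ → X} {g : ℝ → Y} {c : ℝ}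
    (hgf : ∀ᶠ t in l, ‖g t‖ ≤ c * ‖f t‖)
    (hfg : ∀ ε > (0 : ℝ), ∃ C : ℝ, 0 ≤ C ∧
      ∀ᶠ t in l, ‖f (t + 1)‖ ≤ C * Real.exp (ε * |t|) * ‖g t‖) {r : ℝ} :
    Tendsto (fun t => expRate ‖f t‖ₑ t) l (𝓝 (r : EReal)) ↔
      Tendsto (fun t => expRate ‖g t‖ₑ t) l (𝓝 (r : EReal)) := by
  have hgf' : ∀ ε > (0 : ℝ), ∃ C : ℝ, ∀ᶠ t in l,
      ‖g t‖ ≤ C * Real.exp (ε * |t|) * ‖f (t + 0)‖ := by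
    refine fun ε hε => ⟨max c 0, ?_⟩
    filter_upwards [hgf] with t ht
    rw [add_zero]
    refine ht.trans ?_
    have h1 : 1 ≤ Real.exp (ε * |t|) := Real.one_le_exp (by positivity)
    have h2 : c ≤ max c 0 := le_max_left _ _
    have h3 : 0 ≤ max c 0 := le_max_right _ _
    gcongr
    nlinarith
  constructor
  · refine tendsto_expRate_of_le hl hadd 0 1 hgf' fun ε hε => ?_
    obtain ⟨C, -, hC⟩ := hfg ε hε
    exact ⟨C, hC⟩
  · refine tendsto_expRate_of_le hl hadd (-1) 0 (fun ε hε => ?_) (by simpa using hgf')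
    obtain ⟨C, hC0, hC⟩ := hfg ε hε
    refine ⟨C * Real.exp ε, ?_⟩
    filter_upwards [(hadd (-1)).eventually hC] with t ht
    rw [neg_add_cancel_right] at ht
    refine ht.trans ?_
    rw [mul_assoc C (Real.exp ε), ← Real.exp_add]
    have h1 : |t + -1| ≤ |t| + 1 := by simpa using abs_add_le t (-1)
    gcongr
    nlinarith

/-- A function dominated by one with rate `-∞` has no finite rate. -/
theorem not_tendsto_expRate_of_tendsto_bot {f : ℝ → X} {g : ℝ → Y} {c r : ℝ}
    (hgf : ∀ t, ‖g t‖ ≤ c * ‖f t‖)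
    (hf : Tendsto (fun t => expRate ‖f t‖ₑ t) atTop (𝓝 ⊥)) :
    ¬ Tendsto (fun t => expRate ‖g t‖ₑ t) atTop (𝓝 (r : EReal)) := by
  intro hg
  rw [tendsto_expRate_iff tendsto_abs_atTop_atTop] at hg
  obtain ⟨hg0, hg⟩ := hg
  have h1 : ∀ᶠ t in atTop, expRate ‖f t‖ₑ t < ((r - 1 : ℝ) : EReal) :=
    hf.eventually_lt_const (EReal.bot_lt_coe _)
  obtain ⟨t, h1, h2, h3, h4, h5⟩ := (h1.and (hg0.and ((hg (1 / 2) (by norm_num)).and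
    ((eventually_gt_atTop 0).and (eventually_gt_atTop (2 * |Real.log (max c 1)|)))))).exists
  have hgt := norm_pos_iff.2 h2
  have hft : f t ≠ 0 := fun h => by
    have := hgf t
    rw [h, norm_zero, mul_zero] at this
    linarith
  have hm : 0 < max c 1 := zero_lt_one.trans_le (le_max_right _ _)
  have h6 : Real.log ‖g t‖ ≤ Real.log (max c 1) + Real.log ‖f t‖ := by
    rw [← Real.log_mul hm.ne' (norm_pos_iff.2 hft).ne']
    refine Real.log_le_log hgt ((hgf t).trans ?_)
    gcongr
    exact le_max_left _ _
  rw [expRate_enorm hft, EReal.coe_lt_coe_iff, div_lt_iff₀ h4] at h1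
  have h7 := (abs_le.1 h3).1
  rw [abs_of_pos h4] at h7
  have := le_abs_self (Real.log (max c 1))
  linarith

theorem tendsto_add_const_atBot (a : ℝ) : Tendsto (fun t : ℝ => t + a) atBot atBot :=
  tendsto_atBot_add_const_right _ a tendsto_id

theorem tendsto_add_const_atTop (a : ℝ) : Tendsto (fun t : ℝ => t + a) atTop atTop :=
  tendsto_atTop_add_const_right _ a tendsto_id

end

/-! ### Dynamical characterization of Oseledets decompositions -/

section

variable {Ω X Y : Type*} [NormedAddCommGroup X] [NormedSpace ℝ X]
  [NormedAddCommGroup Y] [NormedSpace ℝ Y] {θ : ℝ → Ω → Ω}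

/-- On the zero subspace the operator norm is `0`, with rate `ln 0 = -∞`. -/
theorem exists_ne_zero_of_tendsto_expRate {T : ℝ → X →L[ℝ] X} {E : Submodule ℝ X} {r : ℝ}
    (h : Tendsto (fun t : ℝ => expRate ‖(T t).comp E.subtypeL‖ₑ t) atTop (𝓝 (r : EReal))) :
    ∃ u ∈ E, u ≠ 0 := by
  obtain ⟨t, ht⟩ := ((tendsto_expRate_iff (X := E →L[ℝ] X) tendsto_abs_atTop_atTop).1 h).1.exists
  by_contra hno
  push Not at hno
  refine ht (ContinuousLinearMap.ext fun u => ?_)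
  simp [hno u u.2]

theorem not_tendsto_expRate_of_mem {T : ℝ → X →L[ℝ] X} {F : Submodule ℝ X} {u : X} (hu : u ∈ F)
    (h : Tendsto (fun t : ℝ => expRate ‖(T t).comp F.subtypeL‖ₑ t) atTop (𝓝 ⊥)) (r : ℝ) :
    ¬ Tendsto (fun t => expRate ‖T t u‖ₑ t) atTop (𝓝 (r : EReal)) := by
  refine not_tendsto_expRate_of_tendsto_bot (X := F →L[ℝ] X) (c := ‖u‖) (fun t => ?_) h
  rw [mul_comm]
  exact ((T t).comp F.subtypeL).le_opNorm ⟨u, hu⟩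

/-- The part of an Oseledets decomposition at the point `ω` that determines it: the `lam i`,
`i < n`, are the finite rates of growth of the orbits through `ω`, and the nonzero elements of
`E i` are the vectors with rate `lam i` both forward and along some negative semiorbit. -/
structure HasExponents (θ : ℝ → Ω → Ω) (U : ℝ → Ω → X →L[ℝ] X) (ω : Ω) (n : ℕ∞) (lam : ℕ → ℝ)
    (E : ℕ → Submodule ℝ X) : Prop where
  anti : ∀ i j : ℕ, i < j → (j : ℕ∞) < n → lam j < lam i
  of_rate : ∀ (u : X) (r : ℝ), Tendsto (fun t => expRate ‖U t ω u‖ₑ t) atTop (𝓝 (r : EReal)) →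
    ∃ i : ℕ, (i : ℕ∞) < n ∧ lam i = r
  nontrivial : ∀ i : ℕ, (i : ℕ∞) < n → ∃ u ∈ E i, u ≠ 0
  mem_iff : ∀ i : ℕ, (i : ℕ∞) < n → ∀ u : X, u ≠ 0 → (u ∈ E i ↔
    Tendsto (fun t => expRate ‖U t ω u‖ₑ t) atTop (𝓝 (lam i : EReal)) ∧
    ∃ v : ℝ → X, IsNegativeSemiorbit θ U ω u v ∧
      Tendsto (fun s => expRate ‖v s‖ₑ s) atBot (𝓝 (lam i : EReal)))

/-- A filtration whose successive differences have the rates `lam i`, and whose last term has no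
finite rates, yields the dynamical characterization. -/
theorem HasExponents.of_filtration {U : ℝ → Ω → X →L[ℝ] X} {ω : Ω} {n : ℕ∞} {lam : ℕ → ℝ}
    {E F : ℕ → Submodule ℝ X}
    (anti : ∀ i j : ℕ, i < j → (j : ℕ∞) < n → lam j < lam i)
    (F_zero : F 0 = ⊤) (E_le : ∀ i : ℕ, (i : ℕ∞) < n → E i ≤ F i)
    (nontrivial : ∀ i : ℕ, (i : ℕ∞) < n → ∃ u ∈ E i, u ≠ 0)
    (rate_E : ∀ i : ℕ, (i : ℕ∞) < n → ∀ u ∈ E i, u ≠ 0 →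
      Tendsto (fun t => expRate ‖U t ω u‖ₑ t) atTop (𝓝 (lam i : EReal)))
    (rate_F : ∀ i : ℕ, (i : ℕ∞) < n → ∀ u ∈ F i, u ∉ F (i + 1) →
      Tendsto (fun t => expRate ‖U t ω u‖ₑ t) atTop (𝓝 (lam i : EReal)))
    (mem_E : ∀ i : ℕ, (i : ℕ∞) < n → ∀ u ∈ F i, u ≠ 0 →
      (u ∈ E i ↔ ∃ v : ℝ → X, IsNegativeSemiorbit θ U ω u v ∧
        Tendsto (fun s => expRate ‖v s‖ₑ s) atBot (𝓝 (lam i : EReal))))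
    (last : ∀ u : X, (∀ j : ℕ, (j : ℕ∞) ≤ n → u ∈ F j) → u ≠ 0 → ∀ r : ℝ,
      ¬ Tendsto (fun t => expRate ‖U t ω u‖ₑ t) atTop (𝓝 (r : EReal))) :
    HasExponents θ U ω n lam E := by
  have hlt : ∀ {i j : ℕ}, i < j → (j : ℕ∞) ≤ n → (i : ℕ∞) < n := fun h h' =>
    lt_of_lt_of_le (Nat.cast_lt.2 h) h'
  -- a vector leaves the filtration at the index of its rate
  have step : ∀ (u : X) (j : ℕ), (j : ℕ∞) ≤ n → u ∈ F j ∨ ∃ i < j,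
      Tendsto (fun t => expRate ‖U t ω u‖ₑ t) atTop (𝓝 (lam i : EReal)) := by
    intro u j
    induction j with
    | zero => exact fun _ => Or.inl (by rw [F_zero]; trivial)
    | succ j ih =>
      intro hj
      have hjn : (j : ℕ∞) < n := hlt (Nat.lt_succ_self j) hj
      rcases ih hjn.le with h | ⟨i, hi, h⟩
      · by_cases h' : u ∈ F (j + 1)
        · exact Or.inl h'
        · exact Or.inr ⟨j, Nat.lt_succ_self j, rate_F j hjn u h h'⟩
      · exact Or.inr ⟨i, hi.trans (Nat.lt_succ_self j), h⟩
  refine ⟨anti, fun u r hr => ?_, nontrivial, fun i hi u hu => ?_⟩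
  · have hu : u ≠ 0 := by
      rintro rfl
      obtain ⟨t, ht⟩ := ((tendsto_expRate_iff tendsto_abs_atTop_atTop).1 hr).1.exists
      exact ht (map_zero _)
    by_contra hno
    refine last u (fun j hj => ?_) hu r hr
    rcases step u j hj with h | ⟨i, hi, h⟩
    · exact h
    · have hir : (lam i : EReal) = (r : EReal) := tendsto_nhds_unique h hr
      exact absurd ⟨i, hlt hi hj, EReal.coe_eq_coe_iff.1 hir⟩ hno
  · constructor
    · exact fun h => ⟨rate_E i hi u h hu, (mem_E i hi u (E_le i hi h) hu).1 h⟩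
    · rintro ⟨hr, hv⟩
      refine (mem_E i hi u ?_ hu).2 hv
      rcases step u i hi.le with h | ⟨j, hj, h⟩
      · exact h
      · have hji : (lam j : EReal) = (lam i : EReal) := tendsto_nhds_unique h hr
        exact absurd (EReal.coe_eq_coe_iff.1 hji) (anti j i hj hi).ne'

theorem FiniteOseledets.hasExponents [MeasurableSpace Ω] {P : Measure Ω} {U : ℝ → Ω → X →L[ℝ] X}
    {k : ℕ} (D : FiniteOseledets θ P U k) {ω : Ω} (hω : ω ∈ D.Ω₀) :
    HasExponents θ U ω k (fun i => if h : i < k then D.lam ⟨i, h⟩ else 0)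
      (fun i => if h : i < k then D.E ⟨i, h⟩ ω else ⊥) := by
  have hlast : finiteFiltration D.E D.Finf k ω = D.Finf ω := by
    have : (⨆ (j : Fin k) (_ : k ≤ (j : ℕ)), D.E j ω) = ⊥ := by
      simp only [iSup_eq_bot]
      exact fun j hj => absurd hj j.2.not_ge
    rw [finiteFiltration, this, bot_sup_eq]
  refine HasExponents.of_filtration (F := fun i => finiteFiltration D.E D.Finf i ω)
    ?_ ?_ ?_ ?_ ?_ ?_ ?_ ?_
  · intro i j hij hj
    have hj' : j < k := by exact_mod_cast hj
    simp only [hj', hij.trans hj', dif_pos]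
    exact D.lam_anti hij
  · have := (D.direct_sum ω hω).2.sup_eq_top
    simpa [finiteFiltration] using this
  · intro i hi
    have hi' : i < k := by exact_mod_cast hi
    simp only [hi', dif_pos]
    exact le_sup_of_le_left (le_iSup₂_of_le (⟨i, hi'⟩ : Fin k) le_rfl le_rfl)
  · intro i hi
    have hi' : i < k := by exact_mod_cast hi
    simp only [hi', dif_pos]
    exact exists_ne_zero_of_tendsto_expRate (D.rate_norm_E ⟨i, hi'⟩ ω hω)
  · intro i hi
    have hi' : i < k := by exact_mod_cast hi
    simp only [hi', dif_pos]
    exact D.rate_E ⟨i, hi'⟩ ω hω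
  · intro i hi
    have hi' : i < k := by exact_mod_cast hi
    simp only [hi', dif_pos]
    exact D.rate_filtration ⟨i, hi'⟩ ω hω
  · intro i hi
    have hi' : i < k := by exact_mod_cast hi
    simp only [hi', dif_pos]
    exact D.mem_E_iff ⟨i, hi'⟩ ω hω
  · intro u hu _ r
    have huF : u ∈ D.Finf ω := hlast ▸ hu k le_rfl
    exact not_tendsto_expRate_of_mem huF (D.rate_Finf ω hω) r

theorem InfiniteOseledets.hasExponents [MeasurableSpace Ω] {P : Measure Ω}
    {U : ℝ → Ω → X →L[ℝ] X} (D : InfiniteOseledets θ P U) {ω : Ω} (hω : ω ∈ D.Ω₀) :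
    HasExponents θ U ω ⊤ D.lam (fun i => D.E i ω) := by
  refine HasExponents.of_filtration (F := fun i => D.F i ω)
    (fun i j hij _ => D.lam_anti hij) (D.F_zero ω hω) (fun i _ => ?_)
    (fun i _ => exists_ne_zero_of_tendsto_expRate (D.rate_norm_E i ω hω))
    (fun i _ => D.rate_E i ω hω)
    (fun i _ => D.rate_filtration i ω hω) (fun i _ => D.mem_E_iff i ω hω) ?_
  · rw [(D.F_split i ω hω).2]
    exact le_sup_left
  · intro u hu hu0 r hr
    exact EReal.coe_ne_bot r
      (tendsto_nhds_unique hr (D.rate_Finf ω hω u (fun i => hu i le_top) hu0))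

theorem OseledetsDecomposition.exists_hasExponents [MeasurableSpace Ω] {P : Measure Ω}
    [IsProbabilityMeasure P] {U : ℝ → Ω → X →L[ℝ] X} (D : OseledetsDecomposition θ P U) :
    ∃ lam : ℕ → ℝ, ∀ᵐ ω ∂P, HasExponents θ U ω D.count lam (fun i => D.space i ω) := by
  cases D with
  | caseI k D =>
    have h : ∀ᵐ ω ∂P, ω ∈ D.Ω₀ := (mem_ae_iff_prob_eq_one D.measurableSet).2 D.full
    exact ⟨_, h.mono fun ω hω => D.hasExponents hω⟩
  | caseII D =>
    have h : ∀ᵐ ω ∂P, ω ∈ D.Ω₀ := (mem_ae_iff_prob_eq_one D.measurableSet).2 D.full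
    exact ⟨_, h.mono fun ω hω => D.hasExponents hω⟩

/-! ### Comparison of conjugate semiflows -/

/-- Strictly decreasing enumerations of the same set, finite or infinite, coincide. -/
theorem eq_of_strictAnti_of_image_eq {f g : ℕ → ℝ} {n m : ℕ∞}
    (hf : ∀ i j : ℕ, i < j → (j : ℕ∞) < n → f j < f i)
    (hg : ∀ i j : ℕ, i < j → (j : ℕ∞) < m → g j < g i)
    (hfg : ∀ i : ℕ, (i : ℕ∞) < n → ∃ j : ℕ, (j : ℕ∞) < m ∧ g j = f i)
    (hgf : ∀ i : ℕ, (i : ℕ∞) < m → ∃ j : ℕ, (j : ℕ∞) < n ∧ f j = g i) :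
    n = m ∧ ∀ i : ℕ, (i : ℕ∞) < n → f i = g i := by
  have key : ∀ {f g : ℕ → ℝ} {n m : ℕ∞}, (∀ i j : ℕ, i < j → (j : ℕ∞) < n → f j < f i) →
      (∀ i : ℕ, (i : ℕ∞) < n → ∃ j : ℕ, (j : ℕ∞) < m ∧ g j = f i) → ∀ i : ℕ,
      (∀ i' < i, (i' : ℕ∞) < n → f i' = g i') → (i : ℕ∞) < n →
      ∃ j : ℕ, i ≤ j ∧ (j : ℕ∞) < m ∧ g j = f i := by
    intro f g n m hf hfg i ih hi
    obtain ⟨j, hj, hji⟩ := hfg i hi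
    refine ⟨j, ?_, hj, hji⟩
    by_contra hlt
    push Not at hlt
    have h1 := ih j hlt ((Nat.cast_lt.2 hlt).trans hi)
    exact absurd (h1.trans hji) (hf j i hlt hi).ne'
  have hle : ∀ {f : ℕ → ℝ} {n : ℕ∞}, (∀ i j : ℕ, i < j → (j : ℕ∞) < n → f j < f i) →
      ∀ i j : ℕ, i ≤ j → (j : ℕ∞) < n → f j ≤ f i := by
    intro f n hf i j hij hj
    rcases hij.lt_or_eq with h | rfl
    · exact (hf i j h hj).le
    · exact le_rfl
  have main : ∀ i : ℕ, ((i : ℕ∞) < n ↔ (i : ℕ∞) < m) ∧ ((i : ℕ∞) < n → f i = g i) := by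
    intro i
    induction i using Nat.strong_induction_on with
    | _ i ih =>
      have h1 := key hf hfg i fun i' hi' hn => (ih i' hi').2 hn
      have h2 := key hg hgf i fun i' hi' hm => ((ih i' hi').2 ((ih i' hi').1.2 hm)).symm
      have hiff : (i : ℕ∞) < n ↔ (i : ℕ∞) < m := by
        constructor
        · intro h
          obtain ⟨j, hij, hj, -⟩ := h1 h
          exact (Nat.cast_le.2 hij).trans_lt hj
        · intro h
          obtain ⟨j, hij, hj, -⟩ := h2 h
          exact (Nat.cast_le.2 hij).trans_lt hj
      refine ⟨hiff, fun h => le_antisymm ?_ ?_⟩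
      · obtain ⟨j, hij, hj, hji⟩ := h1 h
        rw [← hji]
        exact hle hg i j hij hj
      · obtain ⟨j, hij, hj, hji⟩ := h2 (hiff.1 h)
        rw [← hji]
        exact hle hf i j hij hj
  refine ⟨?_, fun i => (main i).2⟩
  have le_of : ∀ {n m : ℕ∞}, (∀ i : ℕ, (i : ℕ∞) < n → (i : ℕ∞) < m) → n ≤ m := by
    intro n m h
    by_contra hlt
    push Not at hlt
    lift m to ℕ using hlt.ne_top
    exact (h m hlt).false
  exact le_antisymm (le_of fun i => (main i).1.1) (le_of fun i => (main i).1.2)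

/-- The semiflow `U` on `X` is embedded by `J` in the semiflow `V` on `Y`, and `V` at time `1`
factors through `J` by the maps `K ω`. -/
structure IsSmoothingExtension (θ : ℝ → Ω → Ω)
    (U : ℝ → Ω → X →L[ℝ] X) (V : ℝ → Ω → Y →L[ℝ] Y) (J : X →L[ℝ] Y) (K : Ω → Y →L[ℝ] X) :
    Prop where
  injective : Function.Injective J
  conj : ∀ t, 0 ≤ t → ∀ ω u, J (U t ω u) = V t ω (J u)
  factor : ∀ ω y, J (K ω y) = V 1 ω y
  cocycle : ∀ s t, 0 ≤ s → 0 ≤ t → ∀ ω y, V (s + t) ω y = V t (θ s ω) (V s ω y)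
  continuousOn : ∀ ω u, ContinuousOn (fun t => U t ω u) (Ici 0)

section

variable {U : ℝ → Ω → X →L[ℝ] X} {V : ℝ → Ω → Y →L[ℝ] Y}
  {J : X →L[ℝ] Y} {K : Ω → Y →L[ℝ] X} {ω : Ω}

theorem IsSmoothingExtension.forward_rate_iff (h : IsSmoothingExtension θ U V J K)
    (hK : ∀ ε > (0 : ℝ), ∃ C : ℝ, 0 ≤ C ∧ ∀ s : ℝ, ‖K (θ s ω)‖ ≤ C * Real.exp (ε * |s|))
    {u : X} {r : ℝ} :
    Tendsto (fun t => expRate ‖U t ω u‖ₑ t) atTop (𝓝 (r : EReal)) ↔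
      Tendsto (fun t => expRate ‖V t ω (J u)‖ₑ t) atTop (𝓝 (r : EReal)) := by
  refine tendsto_expRate_iff_of_le tendsto_abs_atTop_atTop tendsto_add_const_atTop (c := ‖J‖) ?_
    fun ε hε => ?_
  · filter_upwards [eventually_ge_atTop 0] with t ht
    rw [← h.conj t ht]
    exact J.le_opNorm _
  · obtain ⟨C, hC0, hC⟩ := hK ε hε
    refine ⟨C, hC0, ?_⟩
    filter_upwards [eventually_ge_atTop 0] with t ht
    have h1 : U (t + 1) ω u = K (θ t ω) (V t ω (J u)) := by
      apply h.injective
      rw [h.factor, h.conj _ (by positivity), h.cocycle _ _ ht zero_le_one]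
    rw [h1]
    exact (K (θ t ω)).le_of_opNorm_le (hC t) _

theorem IsSmoothingExtension.backward_rate_iff (h : IsSmoothingExtension θ U V J K)
    (hK : ∀ ε > (0 : ℝ), ∃ C : ℝ, 0 ≤ C ∧ ∀ s : ℝ, ‖K (θ s ω)‖ ≤ C * Real.exp (ε * |s|))
    {u : X} {v : ℝ → X} (hv : IsNegativeSemiorbit θ U ω u v) {r : ℝ} :
    Tendsto (fun s => expRate ‖v s‖ₑ s) atBot (𝓝 (r : EReal)) ↔
      Tendsto (fun s => expRate ‖J (v s)‖ₑ s) atBot (𝓝 (r : EReal)) := by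
  refine tendsto_expRate_iff_of_le tendsto_abs_atBot_atTop tendsto_add_const_atBot (c := ‖J‖)
    (Eventually.of_forall fun t => J.le_opNorm _) fun ε hε => ?_
  obtain ⟨C, hC0, hC⟩ := hK ε hε
  refine ⟨C, hC0, ?_⟩
  filter_upwards [eventually_le_atBot (-1)] with s hs
  have h1 : v (s + 1) = K (θ s ω) (J (v s)) := by
    apply h.injective
    rw [h.factor, add_comm, hv.orbit s 1 (by linarith) zero_le_one (by linarith),
      h.conj 1 zero_le_one]
  rw [h1]
  exact (K (θ s ω)).le_of_opNorm_le (hC s) _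

theorem IsSmoothingExtension.map_semiorbit (h : IsSmoothingExtension θ U V J K)
    {u : X} {v : ℝ → X} (hv : IsNegativeSemiorbit θ U ω u v) :
    IsNegativeSemiorbit θ V ω (J u) (fun s => J (v s)) := by
  refine ⟨?_, by rw [hv.zero], fun s t hs ht hst => ?_⟩
  · borelize X
    borelize Y
    exact J.continuous.measurable.comp hv.measurable
  · rw [hv.orbit s t hs ht hst, h.conj t ht]

/-- Every negative semiorbit of `V` comes from a negative semiorbit of `U`, which is obtained by
applying the factor one unit of time earlier. It is continuous, because orbits of `U` are. -/
theorem IsSmoothingExtension.exists_semiorbit (h : IsSmoothingExtension θ U V J K)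
    {y : Y} {v : ℝ → Y} (hv : IsNegativeSemiorbit θ V ω y v) :
    ∃ (u : X) (x : ℝ → X), J u = y ∧ IsNegativeSemiorbit θ U ω u x ∧ ∀ s ≤ 0, J (x s) = v s := by
  set x : ℝ → X := fun s => K (θ (s - 1) ω) (v (s - 1)) with hx
  have hJx : ∀ s ≤ 0, J (x s) = v s := by
    intro s hs
    rw [hx, h.factor, ← hv.orbit (s - 1) 1 (by linarith) zero_le_one (by linarith)]
    congr 1
    ring
  have horbit : ∀ s t : ℝ, s ≤ 0 → 0 ≤ t → s + t ≤ 0 → x (t + s) = U t (θ s ω) (x s) := by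
    intro s t hs ht hst
    apply h.injective
    rw [hJx _ (by linarith), h.conj t ht, hJx s hs, hv.orbit s t hs ht hst]
  have hcont : ContinuousOn x (Iic 0) := by
    intro s hs
    -- near `s` the semiorbit is an orbit that starts at time `s - 1`
    have h1 : ContinuousOn x (Icc (s - 1) 0) := by
      have h2 : ContinuousOn (fun r => U (r - (s - 1)) (θ (s - 1) ω) (x (s - 1))) (Icc (s - 1) 0) :=
        (h.continuousOn (θ (s - 1) ω) (x (s - 1))).comp (f := fun r : ℝ => r - (s - 1))
          (by fun_prop) fun r hr => sub_nonneg.2 hr.1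
      refine h2.congr fun r hr => ?_
      have hs' : s - 1 ≤ 0 := hr.1.trans hr.2
      have := horbit (s - 1) (r - (s - 1)) hs' (sub_nonneg.2 hr.1) (by linarith [hr.2])
      rwa [sub_add_cancel] at this
    refine (h1 s ⟨by linarith, hs⟩).mono_of_mem_nhdsWithin ?_
    filter_upwards [self_mem_nhdsWithin, mem_nhdsWithin_of_mem_nhds (Ioi_mem_nhds (sub_one_lt s))]
      with r hr hr'
    exact ⟨le_of_lt hr', hr⟩
  refine ⟨x 0, x, by rw [hJx 0 le_rfl, hv.zero], ⟨?_, rfl, horbit⟩, hJx⟩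
  borelize X
  exact (continuousOn_iff_continuous_domRestrict.1 hcont).measurable

theorem IsSmoothingExtension.compare (h : IsSmoothingExtension θ U V J K)
    (hK : ∀ ε > (0 : ℝ), ∃ C : ℝ, 0 ≤ C ∧ ∀ s : ℝ, ‖K (θ s ω)‖ ≤ C * Real.exp (ε * |s|))
    {n m : ℕ∞} {lam mu : ℕ → ℝ} {E : ℕ → Submodule ℝ X} {G : ℕ → Submodule ℝ Y}
    (hX : HasExponents θ U ω n lam E) (hY : HasExponents θ V ω m mu G) :
    n = m ∧ ∀ i : ℕ, (i : ℕ∞) < n → (E i).map (J : X →ₗ[ℝ] Y) = G i := by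
  have hback : ∀ {y : Y} {v : ℝ → Y} {r : ℝ}, IsNegativeSemiorbit θ V ω y v →
      Tendsto (fun s => expRate ‖v s‖ₑ s) atBot (𝓝 (r : EReal)) →
      ∃ (u : X) (x : ℝ → X), J u = y ∧ IsNegativeSemiorbit θ U ω u x ∧
        Tendsto (fun s => expRate ‖x s‖ₑ s) atBot (𝓝 (r : EReal)) := by
    intro y v r hv hr
    obtain ⟨u, x, hu, hx, hxv⟩ := h.exists_semiorbit hv
    refine ⟨u, x, hu, hx, (h.backward_rate_iff hK hx).2 (hr.congr' ?_)⟩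
    filter_upwards [eventually_le_atBot 0] with s hs
    rw [hxv s hs]
  obtain ⟨hnm, hlm⟩ := eq_of_strictAnti_of_image_eq hX.anti hY.anti
    (fun i hi => by
      obtain ⟨u, hu, hu0⟩ := hX.nontrivial i hi
      exact hY.of_rate (J u) (lam i)
        ((h.forward_rate_iff hK).1 ((hX.mem_iff i hi u hu0).1 hu).1))
    (fun i hi => by
      obtain ⟨y, hy, hy0⟩ := hY.nontrivial i hi
      obtain ⟨hr, v, hv, hvr⟩ := (hY.mem_iff i hi y hy0).1 hy
      obtain ⟨u, x, rfl, -, -⟩ := hback hv hvr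
      exact hX.of_rate u (mu i) ((h.forward_rate_iff hK).2 hr))
  refine ⟨hnm, fun i hi => ?_⟩
  have him : (i : ℕ∞) < m := hnm ▸ hi
  ext y
  rw [Submodule.mem_map]
  constructor
  · rintro ⟨u, hu, rfl⟩
    rcases eq_or_ne u 0 with rfl | hu0
    · simp
    · obtain ⟨hr, v, hv, hvr⟩ := (hX.mem_iff i hi u hu0).1 hu
      have hJu : J u ≠ 0 := fun h0 => hu0 (h.injective (by rw [h0, map_zero]))
      rw [hlm i hi] at hr hvr
      exact (hY.mem_iff i him _ hJu).2 ⟨(h.forward_rate_iff hK).1 hr, _, h.map_semiorbit hv,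
        (h.backward_rate_iff hK hv).1 hvr⟩
  · intro hy
    rcases eq_or_ne y 0 with rfl | hy0
    · exact ⟨0, zero_mem _, map_zero _⟩
    · obtain ⟨hr, v, hv, hvr⟩ := (hY.mem_iff i him y hy0).1 hy
      obtain ⟨u, x, rfl, hx, hxr⟩ := hback hv hvr
      have hu0 : u ≠ 0 := by
        rintro rfl
        exact hy0 (map_zero J)
      rw [← hlm i hi] at hr hxr
      exact ⟨u, (hX.mem_iff i hi u hu0).2 ⟨(h.forward_rate_iff hK).2 hr, x, hx, hxr⟩, rfl⟩

end

end

end DelayRDS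

end

theorem mainTheorem2 {Ω : Type*} [MeasurableSpace Ω] (P : Measure Ω) [IsProbabilityMeasure P]
    (hcomplete : P.IsComplete)
    (θ : ℝ → Ω → Ω) (hθ : IsMetricDynamicalSystem θ P) (hergodic : IsErgodicFlow θ P)
    {N : ℕ} (hN : 2 ≤ N)
    (p q : ℝ≥0∞) [Fact (1 ≤ p)] (hp : 1 < p) (hp' : p < ⊤) (hpq : p.HolderConjugate q)
    (A B : Ω → Matrix (Fin N) (Fin N) ℝ)
    (hA : ∀ i j, Measurable fun ω => A ω i j) (hB : ∀ i j, Measurable fun ω => B ω i j)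
    (hAB : IsSummableCoefficients θ P q A B)
    (DC : OseledetsDecomposition θ P (semiflowC θ q A B))
    (DL : OseledetsDecomposition θ P (semiflowL p θ q A B)) :
    DC.count = DL.count ∧
    ∀ i : ℕ, (i : ℕ∞) < DC.count →
      ∀ᵐ ω ∂P, (DC.space i ω).map (embJ p N : SpaceC N →ₗ[ℝ] SpaceL p N) = DL.space i ω := by
  have hq : 1 ≤ q := ENNReal.HolderConjugate.one_le q p
  have hq' : q ≠ ⊤ := (ENNReal.HolderConjugate.ne_top_iff_ne_one q p).2 hp.ne'
  choose K hKJ hKb using fun ω => exists_factorization (p := p) (q := q) hθ hA hB ω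
  have hext : IsSmoothingExtension θ (semiflowC θ q A B) (semiflowL p θ q A B) (embJ p N) K :=
    { injective := embJ_injective p
      conj := fun t ht ω u => embJ_semiflowC hθ hA hB ht ω u
      factor := hKJ
      cocycle := fun s t hs ht ω y => semiflowL_add hθ hA hB hs ht ω y
      continuousOn := fun ω u => continuousOn_semiflowC p hθ hA hB ω u }
  obtain ⟨lam, hlam⟩ := DC.exists_hasExponents
  obtain ⟨mu, hmu⟩ := DL.exists_hasExponents
  have hall : ∀ᵐ ω ∂P, DC.count = DL.count ∧ ∀ i : ℕ, (i : ℕ∞) < DC.count →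
      (DC.space i ω).map (embJ p N : SpaceC N →ₗ[ℝ] SpaceL p N) = DL.space i ω := by
    filter_upwards [hlam, hmu, ae_subexponential_bound hθ hA hB hq hq' hAB] with ω h1 h2 h3
    refine hext.compare (fun ε hε => ?_) h1 h2
    obtain ⟨C, hC0, hC⟩ := h3 ε hε
    exact ⟨C, hC0, fun s => (hKb (θ s ω)).trans (hC s)⟩
  obtain ⟨ω, hω⟩ := hall.exists
  exact ⟨hω.1, fun i hi => hall.mono fun ω h => h.2 i hi⟩
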